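/- Let $n,d$ be integers with $1\le n\le d$. There is a constant $C=C_{d,n}>0$, depending only on $d$ and $n$, such that the following holds. Let $\{N(t)\}_{t\ge 0}$ be an integer-valued Poisson process of intensity $1$ on a probability space, that is, $N(0)=0$ almost surely, $N$ has independent increments, and $N(t)-N(s)$ is a Poisson random variable of mean $t-s$ for all $0\le s<t$. Let $A\subset\mathbb{N}$ be a finite nonempty set with $|A|$ elements. Then $$\mathbb{E}\,\Big\|\sum_{j\in A}e^{2\pi i yN(j^d)}\Big\|_{L^{2n}(\mathbb{R}/\mathbb{Z},\,dy)}^{2n}\le C\max\Big\{|A|^n,\ |A|^{2n-\frac d2-1}\log^{1+\frac1d}(1+|A|)\Big\}\quad\text{if } d\equiv 2 \pmod 4,$$ and $$\mathbb{E}\,\Big\|\sum_{j\in A}e^{2\pi i yN(j^d)}\Big\|_{L^{2n}(\mathbb{R}/\mathbb{Z},\,dy)}^{2n}\le C\max\Big\{|A|^n,\ |A|^{2n-\frac d2-1}\log^{\frac1d}(1+|A|)\Big\}\quad\text{otherwise.}$$ -/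

import Mathlib

open MeasureTheory ProbabilityTheory
open scoped NNReal ENNReal

/-- `N` is an (integer-valued) Poisson process of intensity `r` on the probability space `(Ω, P)`:
`N 0 = 0` almost surely, `N` has independent increments, and for `s < t` the increment
`N t - N s` is a Poisson random variable of mean `r * (t - s)`. -/
structure IsPoissonProcess {Ω : Type*} [MeasurableSpace Ω] (N : ℝ≥0 → Ω → ℤ) (r : ℝ≥0)
    (P : Measure Ω) : Prop where
  measurable : ∀ t, Measurable (N t)
  zero : ∀ᵐ ω ∂P, N 0 ω = 0
  indepIncrements : HasIndepIncrements N P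
  increment_law : ∀ s t : ℝ≥0, s < t →
    HasLaw (fun ω => N t ω - N s ω)
      ((poissonMeasure (r * (t - s))).map (fun k : ℕ => (k : ℤ))) P

/-- The exponential sum `y ↦ ∑_{j ∈ A} e^{2πi y N(j^d)(ω)}` on the circle `ℝ / ℤ`, for the outcome
`ω`. Here `fourier m y = e^{2πi m y}`. -/
noncomputable def powerExpSum {Ω : Type*} (N : ℝ≥0 → Ω → ℤ) (d : ℕ) (A : Finset ℕ) (ω : Ω) :
    UnitAddCircle → ℂ :=
  fun y => ∑ j ∈ A, fourier (N ((j : ℝ≥0) ^ d) ω) y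

/-!
The `2n`-th moment on the circle counts solutions: by orthogonality of characters the left-hand side
is the sum, over all tuples `t` of `2n` elements of `A`, of the probability that
`∑ (-1) ^ l N(t_l ^ d) = 0`. At the cost of a factor `(2n)!` the tuples may be sorted, the
alternating signs being replaced by an arbitrary balanced sign pattern `ε`
(`lintegral_powerExpSum_le`).

For a monotone tuple `z`, summation by parts turns the signed sum into an integer combination of
independent Poisson increments. The coefficient of an increment is a partial sum of the signs. This
gives two bounds for the probability.

* The increments between `z_{2i}` and `z_{2i+1}` have odd, hence nonzero, coefficients, so that the
  probability is `O((1 + z_{2i+1} ^ d - z_{2i} ^ d) ^ (-1/2))` for every `i`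
  (`IsPoissonProcess.measure_sum_eq_zero_le_of_odd`).
* With `S = ∑ ε_l z_l ^ d` and `z_top` the largest entry, the probability is at most
  `exp (-c S ^ 2 / z_top ^ d)` (`IsPoissonProcess.measure_sum_eq_zero_le_exp`).

By the second bound only the tuples with `S ^ 2 ≲ z_top ^ d log (1 + |A|)` matter. For `d ≥ 3` and
`z_top ≥ log (1 + |A|)` this says `|S| ≲ z_top ^ (d - 1)`, which leaves only boundedly many values of
`z_top` once all the other entries are given (`card_smallPowerSum_fiber_le`). The geometric mean
of the first bounds, taken over the `n - 1` lower pairs, factorizes. So the sum over the tuples is at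
most a constant times `|A|`, for the free entry `z_{2n-2}`, times the `(n - 1)`-st power of
`∑_{x, y ∈ A} (1 + |x ^ d - y ^ d|) ^ (-1 / (2 (n - 1)))`, and the latter sum is
`O(|A| max (1, |A| ^ (1 - d / (2 (n - 1)))))` (`sum_sum_rpow_neg_gap_le`). The result is
`O(max (|A| ^ n, |A| ^ (2n - d/2 - 1)))`.

For `d = n = 2` the same argument loses a factor `log ^ (1/2)`, which the bound permits, and for
`n = 1` the Chernoff bound alone gives `O(|A|)`.
-/

/-! ### The Poisson distribution -/

theorem mul_exp_neg_pow_le {T : ℝ} (hT : 0 ≤ T) {j : ℕ} (hj : j ≠ 0) :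
    T ^ j * Real.exp (-(2 * T)) ≤ ((j : ℝ) / 2) ^ j * Real.exp (-j) := by
  have hj' : (0 : ℝ) < j := by positivity
  have h1 : 2 * T / j ≤ Real.exp (2 * T / j - 1) := by
    have := Real.add_one_le_exp (2 * T / j - 1)
    linarith
  have h2 : (2 * T / j) ^ j ≤ Real.exp (2 * T / j - 1) ^ j :=
    pow_le_pow_left₀ (by positivity) h1 j
  rw [← Real.exp_nat_mul] at h2
  have h3 : (j : ℝ) * (2 * T / j - 1) = 2 * T + -j := by field_simp; ring
  rw [h3, Real.exp_add] at h2
  have h4 : T ^ j = ((j : ℝ) / 2) ^ j * (2 * T / j) ^ j := by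
    rw [← mul_pow]; congr 1; field_simp
  calc T ^ j * Real.exp (-(2 * T))
      ≤ (((j : ℝ) / 2) ^ j * (Real.exp (2 * T) * Real.exp (-j))) * Real.exp (-(2 * T)) := by
        rw [h4]; gcongr
    _ = ((j : ℝ) / 2) ^ j * Real.exp (-j) * (Real.exp (2 * T) * Real.exp (-(2 * T))) := by ring
    _ = _ := by rw [← Real.exp_add]; simp

theorem half_odd_pow_mul_exp_le (k : ℕ) :
    (((2 * k + 1 : ℕ) : ℝ) / 2) ^ (2 * k + 1) * Real.exp (-((2 * k + 1 : ℕ) : ℝ))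
      ≤ (Nat.factorial k : ℝ) ^ 2 := by
  rcases Nat.eq_zero_or_pos k with rfl | hk
  · have : Real.exp (-1) ≤ 1 := Real.exp_le_one_iff.2 (by norm_num)
    norm_num
    linarith
  have hk' : (0 : ℝ) < k := by exact_mod_cast hk
  have hk1 : (1 : ℝ) ≤ k := by exact_mod_cast hk
  have hs := Stirling.le_factorial_stirling k
  have hs2 : 2 * Real.pi * k * ((k : ℝ) / Real.exp 1) ^ (2 * k) ≤ (Nat.factorial k : ℝ) ^ 2 := by
    calc _ = (√(2 * Real.pi * k) * ((k : ℝ) / Real.exp 1) ^ k) ^ 2 := by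
          rw [mul_pow, Real.sq_sqrt (by positivity), ← pow_mul, mul_comm k 2]
      _ ≤ _ := pow_le_pow_left₀ (by positivity) hs 2
  refine le_trans ?_ hs2
  have h1 : (((2 * k + 1 : ℕ) : ℝ) / 2) ^ (2 * k) ≤ (k : ℝ) ^ (2 * k) * Real.exp 1 := by
    have h := Real.add_one_le_exp (1 / (2 * (k : ℝ)))
    have h' := pow_le_pow_left₀ (by positivity) h (2 * k)
    rw [← Real.exp_nat_mul] at h'
    have e1 : ((2 * k : ℕ) : ℝ) * (1 / (2 * (k : ℝ))) = 1 := by push_cast; field_simp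
    rw [e1] at h'
    calc (((2 * k + 1 : ℕ) : ℝ) / 2) ^ (2 * k)
        = (k : ℝ) ^ (2 * k) * (1 / (2 * (k : ℝ)) + 1) ^ (2 * k) := by
          rw [← mul_pow]; congr 1; push_cast; field_simp
          ring
      _ ≤ _ := by gcongr
  have h2 : Real.exp (-((2 * k + 1 : ℕ) : ℝ)) = (1 / Real.exp 1) ^ (2 * k) * Real.exp (-1) := by
    rw [one_div, ← Real.exp_neg, ← Real.exp_nat_mul, ← Real.exp_add]
    congr 1; push_cast; ring
  have hpi := Real.pi_gt_three
  calc (((2 * k + 1 : ℕ) : ℝ) / 2) ^ (2 * k + 1) * Real.exp (-((2 * k + 1 : ℕ) : ℝ))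
      = (((2 * k + 1 : ℕ) : ℝ) / 2) ^ (2 * k) * (((2 * k + 1 : ℕ) : ℝ) / 2)
          * ((1 / Real.exp 1) ^ (2 * k) * Real.exp (-1)) := by rw [pow_succ, h2]
    _ ≤ ((k : ℝ) ^ (2 * k) * Real.exp 1) * (((2 * k + 1 : ℕ) : ℝ) / 2)
          * ((1 / Real.exp 1) ^ (2 * k) * Real.exp (-1)) := by gcongr
    _ = (((2 * k + 1 : ℕ) : ℝ) / 2) * ((k : ℝ) / Real.exp 1) ^ (2 * k)
          * (Real.exp 1 * Real.exp (-1)) := by rw [div_pow, div_pow, one_pow]; ring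
    _ = (((2 * k + 1 : ℕ) : ℝ) / 2) * ((k : ℝ) / Real.exp 1) ^ (2 * k) := by
        rw [← Real.exp_add]; simp
    _ ≤ _ := by
        gcongr
        push_cast
        nlinarith

/-- A local limit bound, uniform in the mass point: the point masses of a Poisson law of mean `T`
are `O((1 + T)^{-1/2})`. For fixed `k` the quantity `T ^ (2 k + 1) e^{-2T}` is largest at
`T = k + 1/2`, where Stirling's formula bounds it by `(k !) ^ 2`. -/
theorem poisson_pmf_le {T : ℝ} (hT : 0 ≤ T) (k : ℕ) :
    Real.exp (-T) * T ^ k / Nat.factorial k ≤ 2 * (1 + T) ^ (-(1 / 2 : ℝ)) := by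
  have hf : (0 : ℝ) < Nat.factorial k := by positivity
  set p := Real.exp (-T) * T ^ k / Nat.factorial k with hp
  have hp0 : 0 ≤ p := by positivity
  have hp1 : p ≤ 1 := by
    rw [hp, Real.exp_neg, div_le_one hf, inv_mul_le_iff₀ (Real.exp_pos _)]
    have := Real.pow_div_factorial_le_exp T hT k
    rwa [div_le_iff₀ hf] at this
  have h2 : T * p ^ 2 ≤ 1 := by
    have h := (mul_exp_neg_pow_le hT (j := 2 * k + 1) (by omega)).trans
      (half_odd_pow_mul_exp_le k)
    have e : T * p ^ 2 = T ^ (2 * k + 1) * Real.exp (-(2 * T)) / (Nat.factorial k : ℝ) ^ 2 := by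
      rw [hp, div_pow, mul_pow, ← Real.exp_nat_mul]
      have : ((2 : ℕ) : ℝ) * -T = -(2 * T) := by push_cast; ring
      rw [this]; ring
    rw [e, div_le_one (by positivity)]
    exact h
  -- Both `p ^ 2` and `T * p ^ 2` are at most `1`.
  have h3 : (1 + T) * p ^ 2 ≤ 4 := by nlinarith
  rw [Real.rpow_neg (by positivity), ← Real.sqrt_eq_rpow]
  have hs : 0 < √(1 + T) := Real.sqrt_pos.2 (by positivity)
  rw [← div_eq_mul_inv, le_div_iff₀ hs]
  refine abs_le_of_sq_le_sq' ?_ (by norm_num) |>.2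
  rw [mul_pow, Real.sq_sqrt (by positivity)]
  linarith

theorem hasSum_exp_mul_poisson (T : ℝ≥0) (t : ℝ) :
    HasSum (fun k : ℕ => Real.exp (-T) * T ^ k / Nat.factorial k * Real.exp (t * k))
      (Real.exp (T * (Real.exp t - 1))) := by
  have h := (NormedSpace.expSeries_div_hasSum_exp ((T : ℝ) * Real.exp t)).mul_left
    (Real.exp (-(T : ℝ)))
  rw [← Real.exp_eq_exp_ℝ, ← Real.exp_add] at h
  have e : (T : ℝ) * (Real.exp t - 1) = -T + T * Real.exp t := by ring
  rw [e]
  refine h.congr_fun fun k => ?_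
  rw [mul_pow, ← Real.exp_nat_mul, mul_comm (k : ℝ) t]
  ring

section law

variable {Ω : Type*} [MeasurableSpace Ω] {P : Measure Ω}

theorem integrable_exp_of_hasLaw_poisson {Y : Ω → ℤ} {T : ℝ≥0}
    (hY : HasLaw Y ((poissonMeasure T).map (fun k : ℕ => (k : ℤ))) P) (t : ℝ) :
    Integrable (fun ω => Real.exp (t * (Y ω : ℝ))) P := by
  have hI : Integrable (fun y : ℤ => Real.exp (t * (y : ℝ)))
      ((poissonMeasure T).map (fun k : ℕ => (k : ℤ))) := by
    refine (integrable_map_measure .of_discrete .of_discrete).2 ?_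
    rw [integrable_poissonMeasure_iff]
    simpa [Function.comp_def] using (hasSum_exp_mul_poisson T t).summable
  rw [← hY.map_eq] at hI
  exact (integrable_map_measure .of_discrete hY.aemeasurable).1 hI

theorem mgf_of_hasLaw_poisson {Y : Ω → ℤ} {T : ℝ≥0}
    (hY : HasLaw Y ((poissonMeasure T).map (fun k : ℕ => (k : ℤ))) P) (t : ℝ) :
    mgf (fun ω => (Y ω : ℝ)) P t = Real.exp (T * (Real.exp t - 1)) := by
  have h := hY.integral_comp (f := fun y : ℤ => Real.exp (t * (y : ℝ))) .of_discrete
  rw [integral_map_cast_poissonMeasure] at h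
  rw [mgf]
  refine Eq.trans h ?_
  simpa using (hasSum_exp_mul_poisson T t).tsum_eq

theorem measure_eq_le_of_hasLaw_poisson {Y : Ω → ℤ} {T : ℝ≥0}
    (hY : HasLaw Y ((poissonMeasure T).map (fun k : ℕ => (k : ℤ))) P) (r : ℤ) :
    P {ω | Y ω = r} ≤ ENNReal.ofReal (2 * (1 + (T : ℝ)) ^ (-(1 / 2 : ℝ))) := by
  rw [hY.measure_eq (p := fun y => y = r) (measurableSet_eq_fun measurable_id measurable_const),
    Measure.map_apply .of_discrete .of_discrete]
  by_cases hr : ∃ k : ℕ, (k : ℤ) = r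
  · obtain ⟨k, rfl⟩ := hr
    have : ((fun k : ℕ => (k : ℤ)) ⁻¹' {x | x = (k : ℤ)}) = {k} := by
      ext j; simp
    rw [this, poissonMeasure_singleton]
    exact ENNReal.ofReal_le_ofReal (poisson_pmf_le T.2 k)
  · have : ((fun k : ℕ => (k : ℤ)) ⁻¹' {x | x = r}) = ∅ := by
      ext j; simpa using fun h => hr ⟨j, h⟩
    rw [this]; simp

/-! ### Small values of combinations of independent Poisson variables -/

variable [IsProbabilityMeasure P] {M : ℕ} {Y : Fin M → Ω → ℤ} {T : Fin M → ℝ≥0} {c : Fin M → ℤ}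

/-- Conditionally on the other summands, the vanishing of the combination prescribes the value of
`Y l`, so any single summand with nonzero coefficient controls the probability. -/
theorem measure_sum_eq_zero_le_of_ne_zero (hm : ∀ l, Measurable (Y l)) (hi : iIndepFun Y P)
    (hY : ∀ l, HasLaw (Y l) ((poissonMeasure (T l)).map (fun k : ℕ => (k : ℤ))) P)
    {l : Fin M} (hl : c l ≠ 0) :
    P {ω | ∑ i, c i * Y i ω = 0} ≤ ENNReal.ofReal (2 * (1 + (T l : ℝ)) ^ (-(1 / 2 : ℝ))) := by
  classical
  set b := ENNReal.ofReal (2 * (1 + (T l : ℝ)) ^ (-(1 / 2 : ℝ)))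
  have hi' : iIndepFun (fun i ω => c i * Y i ω) P :=
    hi.comp (fun i y => c i * y) fun i => .of_discrete
  have hm' : ∀ i, Measurable (fun ω => c i * Y i ω) := fun i =>
    (Measurable.of_discrete (f := fun y : ℤ => c i * y)).comp (hm i)
  set R : Ω → ℤ := ∑ j ∈ Finset.univ.erase l, fun ω => c j * Y j ω with hR
  have hRm : Measurable R := by
    rw [hR, Finset.sum_fn]
    exact Finset.measurable_sum _ fun i _ => hm' i
  have hind : IndepFun R (fun ω => c l * Y l ω) P :=
    hi'.indepFun_finsetSum_of_notMem hm' (Finset.notMem_erase l _)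
  have hsub : {ω | ∑ i, c i * Y i ω = 0} ⊆
      ⋃ r : ℤ, R ⁻¹' {r} ∩ (fun ω => c l * Y l ω) ⁻¹' {-r} := by
    intro ω hω
    simp only [Set.mem_ofPred_eq] at hω
    rw [← Finset.add_sum_erase _ _ (Finset.mem_univ l)] at hω
    simp only [Set.mem_iUnion, Set.mem_inter_iff, Set.mem_preimage, Set.mem_singleton_iff]
    refine ⟨R ω, rfl, ?_⟩
    rw [hR, Finset.sum_apply]
    linarith
  calc P {ω | ∑ i, c i * Y i ω = 0}
      ≤ ∑' r : ℤ, P (R ⁻¹' {r} ∩ (fun ω => c l * Y l ω) ⁻¹' {-r}) :=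
        (measure_mono hsub).trans (measure_iUnion_le _)
    _ ≤ ∑' r : ℤ, P (R ⁻¹' {r}) * b := by
        refine ENNReal.tsum_le_tsum fun r => ?_
        rw [hind.measure_inter_preimage_eq_mul _ _ (measurableSet_singleton _)
          (measurableSet_singleton _)]
        gcongr
        refine le_trans (measure_mono ?_) (measure_eq_le_of_hasLaw_poisson (hY l) (-r / c l))
        intro ω hω
        simp only [Set.mem_preimage, Set.mem_singleton_iff] at hω
        simp only [Set.mem_ofPred_eq]
        rw [← hω, Int.mul_ediv_cancel_left _ hl]
    _ = b := by
        rw [ENNReal.tsum_mul_right]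
        have := tsum_measure_preimage_singleton (μ := P) (f := R) (Set.countable_univ)
          (fun y _ => hRm (measurableSet_singleton y))
        rw [tsum_univ (fun b => P (R ⁻¹' {b}))] at this
        rw [this]; simp

theorem measure_sum_eq_zero_le_exp (hm : ∀ l, Measurable (Y l)) (hi : iIndepFun Y P)
    (hY : ∀ l, HasLaw (Y l) ((poissonMeasure (T l)).map (fun k : ℕ => (k : ℤ))) P) (t : ℝ) :
    P {ω | ∑ i, c i * Y i ω = 0} ≤
      ENNReal.ofReal (Real.exp (∑ i, (T i : ℝ) * (Real.exp (t * c i) - 1))) := by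
  set X : Fin M → Ω → ℝ := fun i ω => (c i : ℝ) * (Y i ω : ℝ) with hX
  have hXm : ∀ i, Measurable (X i) := fun i =>
    (Measurable.of_discrete (f := fun y : ℤ => (c i : ℝ) * (y : ℝ))).comp (hm i)
  have hXi : iIndepFun X P :=
    hi.comp (fun i (y : ℤ) => (c i : ℝ) * (y : ℝ)) fun i => .of_discrete
  have hint : ∀ i, Integrable (fun ω => Real.exp (t * X i ω)) P := fun i => by
    simpa [hX, mul_assoc] using integrable_exp_of_hasLaw_poisson (hY i) (t * c i)
  have hmgf : mgf (∑ i, X i) P t = Real.exp (∑ i, (T i : ℝ) * (Real.exp (t * c i) - 1)) := by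
    rw [hXi.mgf_sum hXm, Real.exp_sum]
    refine Finset.prod_congr rfl fun i _ => ?_
    rw [hX, mgf_const_mul, mul_comm, mgf_of_hasLaw_poisson (hY i)]
  have hI : Integrable (fun ω => Real.exp (t * (∑ i, X i) ω)) P :=
    hXi.integrable_exp_mul_sum hXm fun i _ => hint i
  have hset : MeasurableSet {ω | (∑ i, X i) ω = 0} := by
    rw [Finset.sum_fn]
    exact (Finset.measurable_sum _ fun i _ => hXm i) (measurableSet_singleton 0)
  rw [← hmgf, mgf, ofReal_integral_eq_lintegral_ofReal hI (ae_of_all _ fun ω => (Real.exp_pos _).le)]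
  have he : {ω | ∑ i, c i * Y i ω = 0} = {ω | (∑ i, X i) ω = 0} := by
    ext ω
    simp only [Set.mem_ofPred_eq, hX, Finset.sum_apply]
    exact_mod_cast Iff.rfl
  rw [he, ← lintegral_indicator_one hset]
  refine lintegral_mono fun ω => ?_
  by_cases h : (∑ i, X i) ω = 0
  · simp only [Set.indicator, Set.mem_ofPred_eq, h]; simp
  · simp only [Set.indicator, Set.mem_ofPred_eq, h]; simp

/-- A Chernoff bound with Gaussian decay. Since the coefficients are integers, the mean `μ` satisfies
`|μ| ≤ V` for every upper bound `V` of the variance, so that the tilting parameter `-μ / (2 B V)`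
keeps all the exponents `t * c i` in the range where `e ^ x ≤ 1 + x + x ^ 2`. -/
theorem measure_sum_eq_zero_le_exp_sq_div (hm : ∀ l, Measurable (Y l)) (hi : iIndepFun Y P)
    (hY : ∀ l, HasLaw (Y l) ((poissonMeasure (T l)).map (fun k : ℕ => (k : ℤ))) P)
    {B : ℝ} (hB : 1 ≤ B) (hc : ∀ i, |(c i : ℝ)| ≤ B)
    {V : ℝ} (hV : ∑ i, (c i : ℝ) ^ 2 * T i ≤ V) :
    P {ω | ∑ i, c i * Y i ω = 0} ≤
      ENNReal.ofReal (Real.exp (-((∑ i, (c i : ℝ) * T i) ^ 2 / (4 * B * V)))) := by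
  set μ := ∑ i, (c i : ℝ) * T i with hμ
  have hV0 : 0 ≤ V := (Finset.sum_nonneg fun i _ => by positivity).trans hV
  rcases hV0.eq_or_lt with h0 | hVpos
  · rw [← h0]; simpa using prob_le_one
  have hμV : |μ| ≤ V := by
    refine (Finset.abs_sum_le_sum_abs _ _).trans ((Finset.sum_le_sum fun i _ => ?_).trans hV)
    rw [abs_mul, NNReal.abs_eq, ← sq_abs]
    refine mul_le_mul_of_nonneg_right ?_ (T i).2
    rcases eq_or_ne (c i) 0 with h | h
    · simp [h]
    · have : (1 : ℝ) ≤ |(c i : ℝ)| := by exact_mod_cast Int.one_le_abs h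
      nlinarith
  set t := -μ / (2 * B * V) with ht
  have htc : ∀ i, |t * c i| ≤ 1 := fun i => by
    rw [abs_mul, ht, abs_div, abs_neg, abs_of_pos (by positivity : 0 < 2 * B * V), div_mul_eq_mul_div,
      div_le_one (by positivity)]
    have := mul_le_mul hμV (hc i) (abs_nonneg _) hV0
    nlinarith [mul_nonneg hV0 (by linarith : 0 ≤ B)]
  refine (measure_sum_eq_zero_le_exp hm hi hY t).trans (ENNReal.ofReal_le_ofReal ?_)
  refine Real.exp_le_exp.2 ?_
  calc ∑ i, (T i : ℝ) * (Real.exp (t * c i) - 1)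
      ≤ ∑ i, (T i : ℝ) * (t * c i + (t * c i) ^ 2) := by
        refine Finset.sum_le_sum fun i _ => mul_le_mul_of_nonneg_left ?_ (T i).2
        have := (abs_le.1 (Real.abs_exp_sub_one_sub_id_le (htc i))).2
        linarith
    _ = t * μ + t ^ 2 * ∑ i, (c i : ℝ) ^ 2 * T i := by
        rw [hμ, Finset.mul_sum, Finset.mul_sum, ← Finset.sum_add_distrib]
        exact Finset.sum_congr rfl fun i _ => by ring
    _ ≤ t * μ + t ^ 2 * V := by gcongr
    _ = -(μ ^ 2 / (2 * B * V)) + μ ^ 2 / (4 * B * V) / B := by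
        rw [ht]; field_simp; ring
    _ ≤ -(μ ^ 2 / (2 * B * V)) + μ ^ 2 / (4 * B * V) := by
        refine add_le_add le_rfl ?_
        exact div_le_self (a := μ ^ 2 / (4 * B * V)) (by positivity) hB
    _ = -(μ ^ 2 / (4 * B * V)) := by field_simp; ring

end law

/-! ### Signed sums of values of a Poisson process -/

/-- Summation by parts. -/
theorem sum_mul_eq_mul_last_sub {R : Type*} [CommRing R] {M : ℕ} (ε f : Fin (M + 1) → R) :
    ∑ l, ε l * f l = (∑ l, ε l) * f (Fin.last M)
      - ∑ l : Fin M, (∑ i, if i ≤ l.castSucc then ε i else 0) * (f l.succ - f l.castSucc) := by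
  induction M with
  | zero => simp [Fin.last]
  | succ M ih =>
    rw [Fin.sum_univ_castSucc, ih (fun i => ε i.castSucc) (fun i => f i.castSucc),
      Fin.sum_univ_castSucc ε, Fin.sum_univ_castSucc (n := M) (fun l => _ * (f l.succ - _))]
    have h1 : ∀ l : Fin M, (∑ i : Fin (M + 1 + 1), if i ≤ l.castSucc.castSucc then ε i else 0)
        = ∑ i : Fin (M + 1), if i ≤ l.castSucc then ε i.castSucc else 0 := fun l => by
      rw [Fin.sum_univ_castSucc, if_neg (by simp [Fin.le_def]), add_zero]
      simp
    have h2 : (∑ i : Fin (M + 1 + 1), if i ≤ (Fin.last M).castSucc then ε i else 0)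
        = ∑ i : Fin (M + 1), ε i.castSucc := by
      rw [Fin.sum_univ_castSucc, if_neg (by simp [Fin.le_def]), add_zero]
      refine Finset.sum_congr rfl fun i _ => if_pos ?_
      simp [Fin.le_last]
    simp only [h1, h2, Fin.succ_castSucc, Fin.succ_last]
    ring

section process

variable {Ω : Type*} [MeasurableSpace Ω] {P : Measure Ω} [IsProbabilityMeasure P]
  {N : ℝ≥0 → Ω → ℤ} {M : ℕ}

theorem IsPoissonProcess.hasLaw_sub (hN : IsPoissonProcess N 1 P) {s t : ℝ≥0} (h : s ≤ t) :
    HasLaw (fun ω => N t ω - N s ω) ((poissonMeasure (t - s)).map (fun k : ℕ => (k : ℤ))) P := by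
  rcases h.eq_or_lt with rfl | h
  · have h0 : poissonMeasure 0 = Measure.dirac 0 := by
      refine Measure.ext_of_singleton fun k => ?_
      rw [poissonMeasure_singleton]
      rcases eq_or_ne k 0 with rfl | hk
      · simp
      · simp [hk, hk.symm]
    refine ⟨by simp, ?_⟩
    simp only [sub_self, tsub_self]
    rw [h0, Measure.map_const, Measure.map_dirac' .of_discrete]
    simp
  · simpa using hN.increment_law s t h

/-- The coefficient of the increment `N (t (l + 1)) - N (t l)` in the signed sum is, up to sign, the
partial sum of the signs up to `l`; if that is odd then it does not vanish. -/
theorem IsPoissonProcess.measure_sum_eq_zero_le_of_odd (hN : IsPoissonProcess N 1 P)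
    {t : Fin (M + 1) → ℝ≥0} (ht : Monotone t) {ε : Fin (M + 1) → ℤ} (hε : ∑ l, ε l = 0)
    {l : Fin M} (hl : Odd (∑ i, if i ≤ l.castSucc then ε i else 0)) :
    P {ω | ∑ l, ε l * N (t l) ω = 0} ≤
      ENNReal.ofReal (2 * (1 + ((t l.succ : ℝ) - t l.castSucc)) ^ (-(1 / 2 : ℝ))) := by
  have h := measure_sum_eq_zero_le_of_ne_zero
    (c := fun l : Fin M => ∑ i, if i ≤ l.castSucc then ε i else 0)
    (fun l => (hN.measurable (t l.succ)).sub (hN.measurable (t l.castSucc)))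
    (hN.indepIncrements M t ht) (fun l => hN.hasLaw_sub (ht l.castSucc_le_succ))
    (l := l) (by rintro h; simp [h] at hl)
  rw [NNReal.coe_sub (ht l.castSucc_le_succ)] at h
  refine le_of_eq_of_le ?_ h
  congr 1 with ω
  simp only [Set.mem_ofPred_eq]
  rw [sum_mul_eq_mul_last_sub ε fun l => N (t l) ω, hε]
  simp

/-- The coefficients of the increments are at most `M + 1` in absolute value, so the variance of the
signed sum is at most `(M + 1) ^ 2 * W`. -/
theorem IsPoissonProcess.measure_sum_eq_zero_le_exp (hN : IsPoissonProcess N 1 P)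
    {t : Fin (M + 1) → ℝ≥0} (ht : Monotone t) {ε : Fin (M + 1) → ℤ} (hε : ∑ l, ε l = 0)
    (hε1 : ∀ l, |ε l| = 1) {W : ℝ} (hW : (t (Fin.last M) : ℝ) - t 0 ≤ W) :
    P {ω | ∑ l, ε l * N (t l) ω = 0} ≤
      ENNReal.ofReal (Real.exp (-((∑ l, (ε l : ℝ) * t l) ^ 2 / (4 * ((M : ℝ) + 1) ^ 3 * W)))) := by
  set c : Fin M → ℤ := fun l : Fin M => ∑ i, if i ≤ l.castSucc then ε i else 0 with hc
  have hcB : ∀ l, |(c l : ℝ)| ≤ (M : ℝ) + 1 := fun l => by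
    have : |c l| ≤ (M : ℤ) + 1 := by
      calc |c l| ≤ ∑ i : Fin (M + 1), |if i ≤ l.castSucc then ε i else 0| :=
            Finset.abs_sum_le_sum_abs _ _
        _ ≤ ∑ i : Fin (M + 1), 1 := Finset.sum_le_sum fun i _ => by
            split_ifs
            · exact (hε1 i).le
            · simp
        _ = (M : ℤ) + 1 := by simp
    exact_mod_cast this
  have htel : ∑ l : Fin M, ((t l.succ : ℝ) - t l.castSucc) = t (Fin.last M) - t 0 := by
    have h := sum_mul_eq_mul_last_sub (R := ℝ) (fun l : Fin (M + 1) => if l = 0 then 1 else 0)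
      (fun l => (t l : ℝ))
    have h1 : ∀ l : Fin M, (∑ i : Fin (M + 1), if i ≤ l.castSucc then
        (if i = 0 then (1 : ℝ) else 0) else 0) = 1 := fun l => by
      rw [Finset.sum_eq_single 0 (fun i _ hi => by simp [hi]) (by simp)]
      simp
    simp only [h1, ite_mul, one_mul, zero_mul, Finset.sum_ite_eq', Finset.mem_univ, if_true] at h
    linarith
  have hV : ∑ l, (c l : ℝ) ^ 2 * ((t l.succ - t l.castSucc : ℝ≥0) : ℝ) ≤ ((M : ℝ) + 1) ^ 2 * W := by
    calc _ ≤ ∑ l : Fin M, ((M : ℝ) + 1) ^ 2 * ((t l.succ : ℝ) - t l.castSucc) :=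
          Finset.sum_le_sum fun l _ => by
            rw [NNReal.coe_sub (ht l.castSucc_le_succ)]
            refine mul_le_mul_of_nonneg_right ?_
              (sub_nonneg.2 (by exact_mod_cast ht l.castSucc_le_succ))
            rw [← sq_abs]
            exact pow_le_pow_left₀ (abs_nonneg _) (hcB l) 2
      _ ≤ _ := by rw [← Finset.mul_sum, htel]; gcongr
  have h := measure_sum_eq_zero_le_exp_sq_div (c := c)
    (fun l => (hN.measurable (t l.succ)).sub (hN.measurable (t l.castSucc)))
    (hN.indepIncrements M t ht) (fun l => hN.hasLaw_sub (ht l.castSucc_le_succ))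
    (B := (M : ℝ) + 1) (by simp) hcB hV
  have hμ : ∑ l, (ε l : ℝ) * t l
      = -∑ l, (c l : ℝ) * ((t l.succ - t l.castSucc : ℝ≥0) : ℝ) := by
    rw [sum_mul_eq_mul_last_sub (fun l => (ε l : ℝ)) fun l => (t l : ℝ)]
    have : ∑ l, (ε l : ℝ) = 0 := by exact_mod_cast hε
    rw [this, zero_mul, zero_sub, hc]
    congr 1
    refine Finset.sum_congr rfl fun l _ => ?_
    rw [NNReal.coe_sub (ht l.castSucc_le_succ)]
    push_cast
    rfl
  have e : 4 * ((M : ℝ) + 1) ^ 3 * W = 4 * ((M : ℝ) + 1) * (((M : ℝ) + 1) ^ 2 * W) := by ring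
  rw [hμ, neg_sq, e]
  refine le_of_eq_of_le ?_ h
  congr 1 with ω
  simp only [Set.mem_ofPred_eq]
  rw [sum_mul_eq_mul_last_sub ε fun l => N (t l) ω, hε]
  simp [hc]

end process

/-! ### Sums over pairs with weight a negative power of the gap -/

theorem sum_Icc_rpow_neg_half_le (r : ℕ) :
    ∑ h ∈ Finset.Icc 1 r, (h : ℝ) ^ (-(1 / 2 : ℝ)) ≤ 2 * √r := by
  induction r with
  | zero => simp
  | succ r ih =>
    rw [Finset.sum_Icc_succ_top (by omega)]
    refine (add_le_add_left ih _).trans ?_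
    rw [Real.rpow_neg (by positivity), ← Real.sqrt_eq_rpow]
    have ha : 0 ≤ √(r : ℝ) := Real.sqrt_nonneg _
    have hb : 0 < √((r + 1 : ℕ) : ℝ) := Real.sqrt_pos.2 (by positivity)
    have ha2 : √(r : ℝ) ^ 2 = r := Real.sq_sqrt (by positivity)
    have hb2 : √((r + 1 : ℕ) : ℝ) ^ 2 = r + 1 := by
      rw [Real.sq_sqrt (by positivity)]; push_cast; ring
    set a := √(r : ℝ)
    set b := √((r + 1 : ℕ) : ℝ)
    have : b⁻¹ ≤ 2 * (b - a) := by
      rw [inv_le_iff_one_le_mul₀ hb]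
      nlinarith [sq_nonneg (b - a)]
    linarith

theorem sum_Icc_rpow_neg_le {α : ℝ} (hα : α ≤ 1 / 2) (r : ℕ) :
    ∑ h ∈ Finset.Icc 1 r, (h : ℝ) ^ (-α) ≤ 2 * (r : ℝ) ^ (1 - α) := by
  rcases Nat.eq_zero_or_pos r with rfl | hr
  · simp only [zero_lt_one, Finset.Icc_eq_empty_of_lt, Finset.sum_empty]; positivity
  have hr' : (0 : ℝ) < r := by exact_mod_cast hr
  calc ∑ h ∈ Finset.Icc 1 r, (h : ℝ) ^ (-α)
      ≤ ∑ h ∈ Finset.Icc 1 r, (r : ℝ) ^ (1 / 2 - α) * (h : ℝ) ^ (-(1 / 2 : ℝ)) := by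
        refine Finset.sum_le_sum fun h hh => ?_
        rw [Finset.mem_Icc] at hh
        have hh' : (0 : ℝ) < h := by exact_mod_cast hh.1
        have : (h : ℝ) ^ (-α) = (h : ℝ) ^ (1 / 2 - α) * (h : ℝ) ^ (-(1 / 2 : ℝ)) := by
          rw [← Real.rpow_add hh']; congr 1; ring
        rw [this]
        have h2 : (h : ℝ) ≤ r := by exact_mod_cast hh.2
        gcongr
    _ ≤ (r : ℝ) ^ (1 / 2 - α) * (2 * √r) := by
        rw [← Finset.mul_sum]
        gcongr
        exact sum_Icc_rpow_neg_half_le r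
    _ = 2 * (r : ℝ) ^ (1 - α) := by
        rw [Real.sqrt_eq_rpow]
        have : (1 : ℝ) - α = (1 / 2 - α) + 1 / 2 := by ring
        rw [this, Real.rpow_add hr']; ring

/-- Among all sets of `r` positive distances the sum is largest for the distances `1, …, r`; up to
the constant this is seen by separating the distances at most `r` from the others. -/
theorem sum_rpow_neg_sub_le {α : ℝ} (h0 : 0 ≤ α) (hα : α ≤ 1 / 2) {x : ℕ} {B : Finset ℕ}
    (hB : ∀ y ∈ B, y < x) :
    ∑ y ∈ B, ((x : ℝ) - y) ^ (-α) ≤ 3 * (B.card : ℝ) ^ (1 - α) := by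
  set r := B.card with hr
  rcases Nat.eq_zero_or_pos r with h | hr0
  · rw [Finset.card_eq_zero.1 (hr.symm.trans h), Finset.sum_empty]; positivity
  have hr' : (0 : ℝ) < r := by exact_mod_cast hr0
  rw [← Finset.sum_filter_add_sum_filter_not B (fun y => x - y ≤ r)]
  have h1 : ∑ y ∈ B with x - y ≤ r, ((x : ℝ) - y) ^ (-α) ≤ 2 * (r : ℝ) ^ (1 - α) := by
    refine le_trans ?_ (sum_Icc_rpow_neg_le hα r)
    have hinj : Set.InjOn (fun y => x - y) ((B.filter fun y => x - y ≤ r : Finset ℕ) : Set ℕ) := by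
      intro y hy y' hy' h
      have h1 := hB y (Finset.mem_filter.1 hy).1
      have h2 := hB y' (Finset.mem_filter.1 hy').1
      simp only at h
      omega
    have e : ∑ y ∈ B with x - y ≤ r, ((x : ℝ) - y) ^ (-α)
        = ∑ h ∈ (B.filter fun y => x - y ≤ r).image (fun y => x - y), (h : ℝ) ^ (-α) := by
      rw [Finset.sum_image hinj]
      refine Finset.sum_congr rfl fun y hy => ?_
      rw [Nat.cast_sub (hB y (Finset.mem_filter.1 hy).1).le]
    rw [e]
    refine Finset.sum_le_sum_of_subset_of_nonneg ?_ fun _ _ _ => by positivity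
    intro h hh
    obtain ⟨y, hy, rfl⟩ := Finset.mem_image.1 hh
    rw [Finset.mem_filter] at hy
    have := hB y hy.1
    exact Finset.mem_Icc.2 ⟨by omega, hy.2⟩
  have h2 : ∑ y ∈ B with ¬ x - y ≤ r, ((x : ℝ) - y) ^ (-α) ≤ (r : ℝ) ^ (1 - α) := by
    calc ∑ y ∈ B with ¬ x - y ≤ r, ((x : ℝ) - y) ^ (-α)
        ≤ ∑ y ∈ B with ¬ x - y ≤ r, (r : ℝ) ^ (-α) := by
          refine Finset.sum_le_sum fun y hy => ?_
          rw [Finset.mem_filter] at hy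
          have := hB y hy.1
          have h' : (r : ℝ) ≤ (x : ℝ) - y := by
            rw [← Nat.cast_sub this.le]; exact_mod_cast (not_le.1 hy.2).le
          exact Real.rpow_le_rpow_of_nonpos hr' h' (by linarith)
      _ ≤ ∑ y ∈ B, (r : ℝ) ^ (-α) :=
          Finset.sum_le_sum_of_subset_of_nonneg (Finset.filter_subset _ _)
            fun _ _ _ => by positivity
      _ = (r : ℝ) ^ (1 - α) := by
          rw [Finset.sum_const, nsmul_eq_mul, ← hr, sub_eq_add_neg, Real.rpow_add hr', Real.rpow_one]
  linarith

theorem mul_sub_le_pow_sub_pow {d : ℕ} (hd : 1 ≤ d) {x y : ℕ} (h : y ≤ x) :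
    (x : ℝ) ^ (d - 1) * ((x : ℝ) - y) ≤ (x : ℝ) ^ d - (y : ℝ) ^ d := by
  obtain ⟨e, rfl⟩ := Nat.exists_eq_add_of_le' hd
  have h' : (y : ℝ) ≤ x := by exact_mod_cast h
  have := pow_le_pow_left₀ (by positivity) h' e
  rw [Nat.add_sub_cancel, pow_succ, pow_succ]
  nlinarith [mul_le_mul_of_nonneg_right this (Nat.cast_nonneg (α := ℝ) y)]

theorem sum_lt_rpow_neg_gap_le {d : ℕ} (hd : 1 ≤ d) {α : ℝ} (h0 : 0 ≤ α) (hα : α ≤ 1 / 2)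
    (A : Finset ℕ) (x : ℕ) :
    ∑ y ∈ A with y < x, (1 + |(x : ℝ) ^ d - (y : ℝ) ^ d|) ^ (-α)
      ≤ 3 * max 1 ((A.card : ℝ) ^ (1 - d * α)) := by
  set B := A.filter (· < x) with hB
  have hBx : ∀ y ∈ B, y < x := fun y hy => (Finset.mem_filter.1 hy).2
  rcases Nat.eq_zero_or_pos B.card with h | hr0
  · rw [Finset.card_eq_zero.1 h]; simp only [Finset.sum_empty]; positivity
  have hr' : (0 : ℝ) < B.card := by exact_mod_cast hr0
  have hr1 : (1 : ℝ) ≤ B.card := by exact_mod_cast hr0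
  have hrx : B.card ≤ x := by
    have : B ⊆ Finset.range x := fun y hy => Finset.mem_range.2 (hBx y hy)
    simpa using Finset.card_le_card this
  have hrx' : (B.card : ℝ) ≤ x := by exact_mod_cast hrx
  have hrm : (B.card : ℝ) ≤ A.card := by exact_mod_cast Finset.card_le_card (Finset.filter_subset _ _)
  calc ∑ y ∈ B, (1 + |(x : ℝ) ^ d - (y : ℝ) ^ d|) ^ (-α)
      ≤ ∑ y ∈ B, ((B.card : ℝ) ^ (d - 1)) ^ (-α) * ((x : ℝ) - y) ^ (-α) := by
        refine Finset.sum_le_sum fun y hy => ?_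
        have hy' : (0 : ℝ) < (x : ℝ) - y := sub_pos.2 (by exact_mod_cast hBx y hy)
        rw [← Real.mul_rpow (by positivity) hy'.le]
        refine Real.rpow_le_rpow_of_nonpos (by positivity) ?_ (by linarith)
        have h1 := mul_sub_le_pow_sub_pow hd (hBx y hy).le
        have h2 : (B.card : ℝ) ^ (d - 1) * ((x : ℝ) - y) ≤ (x : ℝ) ^ (d - 1) * ((x : ℝ) - y) := by
          gcongr
        have h3 := le_abs_self ((x : ℝ) ^ d - (y : ℝ) ^ d)
        linarith
    _ ≤ ((B.card : ℝ) ^ (d - 1)) ^ (-α) * (3 * (B.card : ℝ) ^ (1 - α)) := by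
        rw [← Finset.mul_sum]
        gcongr
        exact sum_rpow_neg_sub_le h0 hα hBx
    _ = 3 * (B.card : ℝ) ^ (1 - d * α) := by
        rw [← Real.rpow_natCast, ← Real.rpow_mul hr'.le, mul_left_comm, ← Real.rpow_add hr']
        congr 2
        rw [Nat.cast_sub hd]; push_cast; ring
    _ ≤ 3 * max 1 ((A.card : ℝ) ^ (1 - d * α)) := by
        gcongr
        rcases le_total (1 - d * α) 0 with h | h
        · exact le_max_of_le_left (Real.rpow_le_one_of_one_le_of_nonpos hr1 h)
        · exact le_max_of_le_right (Real.rpow_le_rpow hr'.le hrm h)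

/-- The gap satisfies `x ^ d - y ^ d ≥ x ^ (d - 1) (x - y)` for `y < x`, and `x` is at least the
number `r` of elements of `A` below it, so that the sum over `y < x` is `O(r ^ (1 - d α))`. -/
theorem sum_sum_rpow_neg_gap_le {d : ℕ} (hd : 1 ≤ d) {α : ℝ} (h0 : 0 ≤ α) (hα : α ≤ 1 / 2)
    (A : Finset ℕ) :
    ∑ q ∈ A ×ˢ A, (1 + |(q.2 : ℝ) ^ d - (q.1 : ℝ) ^ d|) ^ (-α)
      ≤ 7 * (A.card * max 1 ((A.card : ℝ) ^ (1 - d * α))) := by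
  set f : ℕ → ℕ → ℝ := fun x y => (1 + |(x : ℝ) ^ d - (y : ℝ) ^ d|) ^ (-α) with hf
  set m := max 1 ((A.card : ℝ) ^ (1 - d * α)) with hm
  have hsymm : ∀ x y, f x y = f y x := fun x y => by rw [hf]; simp only [abs_sub_comm]
  have h1 : ∑ x ∈ A, ∑ y ∈ A, (if y < x then f x y else 0) ≤ A.card * (3 * m) := by
    rw [← nsmul_eq_mul]
    refine Finset.sum_le_card_nsmul _ _ _ fun x _ => ?_
    rw [← Finset.sum_filter]
    exact sum_lt_rpow_neg_gap_le hd h0 hα A x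
  have h2 : ∑ x ∈ A, ∑ y ∈ A, (if y = x then (1 : ℝ) else 0) ≤ A.card * m := by
    rw [← nsmul_eq_mul]
    refine Finset.sum_le_card_nsmul _ _ _ fun x hx => ?_
    simp [hx, hm]
  calc ∑ q ∈ A ×ˢ A, (1 + |(q.2 : ℝ) ^ d - (q.1 : ℝ) ^ d|) ^ (-α)
      = ∑ x ∈ A, ∑ y ∈ A, f x y := by
        rw [Finset.sum_product]
        exact Finset.sum_congr rfl fun x _ => Finset.sum_congr rfl fun y _ => hsymm y x
    _ = ∑ x ∈ A, ∑ y ∈ A, ((if y < x then f x y else 0) + (if x < y then f y x else 0)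
          + (if y = x then 1 else 0)) := by
        refine Finset.sum_congr rfl fun x _ => Finset.sum_congr rfl fun y _ => ?_
        rcases lt_trichotomy x y with h | h | h
        · simp [h, h.le, h.ne', hsymm x y]
        · subst h; simp [hf]
        · simp [h, h.le, h.ne]
    _ = ∑ x ∈ A, ∑ y ∈ A, (if y < x then f x y else 0)
          + ∑ x ∈ A, ∑ y ∈ A, (if y < x then f x y else 0)
          + ∑ x ∈ A, ∑ y ∈ A, (if y = x then (1 : ℝ) else 0) := by
        simp only [Finset.sum_add_distrib]
        congr 2
        exact Finset.sum_comm
    _ ≤ _ := by linarith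

/-! ### Monotone tuples with few values of the largest entry -/

/-- The `i`-th pair `(z_{2i}, z_{2i+1})` of consecutive entries of a tuple of length `2 k + 2`, for
`i < k`; the last pair is left out. -/
def lowerPairs {k : ℕ} (z : Fin (2 * k + 1 + 1) → ℕ) (i : Fin k) : ℕ × ℕ :=
  (z ⟨2 * i, by omega⟩, z ⟨2 * i + 1, by omega⟩)

/-- The tuples with entries in `A` whose largest entry `z_top` is positive and whose signed power
sum is at most `D z_top ^ (d - 1)`. -/
noncomputable def smallPowerSum {M : ℕ} (d : ℕ) (D : ℝ) (ε : Fin (M + 1) → ℤ) (A : Finset ℕ) :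
    Finset (Fin (M + 1) → ℕ) :=
  (Fintype.piFinset fun _ => A).filter fun z =>
    1 ≤ z (Fin.last M) ∧ |∑ l, (ε l : ℝ) * (z l : ℝ) ^ d| ≤ D * (z (Fin.last M) : ℝ) ^ (d - 1)

theorem card_le_of_forall_sub_le {I : Finset ℕ} {D : ℝ} (hD : 0 ≤ D)
    (h : ∀ v ∈ I, ∀ w ∈ I, w ≤ v → (v : ℝ) - w ≤ D) : (I.card : ℝ) ≤ D + 1 := by
  rcases I.eq_empty_or_nonempty with rfl | hI
  · simp; linarith
  have hsub : I ⊆ Finset.Icc (I.min' hI) (I.min' hI + ⌊D⌋₊) := fun v hv => by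
    have h1 := I.min'_le v hv
    refine Finset.mem_Icc.2 ⟨h1, ?_⟩
    have h2 := h v hv _ (I.min'_mem hI) h1
    rw [← Nat.cast_sub h1] at h2
    have := Nat.le_floor h2
    omega
  have hc := Finset.card_le_card hsub
  rw [Nat.card_Icc] at hc
  have hc' : I.card ≤ ⌊D⌋₊ + 1 := by omega
  calc (I.card : ℝ) ≤ (⌊D⌋₊ : ℝ) + 1 := by exact_mod_cast hc'
    _ ≤ D + 1 := by gcongr; exact Nat.floor_le hD

/-- All entries but the largest one being given, the largest one is confined to an interval of
length `2 D`, because consecutive `d`-th powers near `v` are at distance at least `v ^ (d - 1)`. -/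
theorem card_smallPowerSum_fiber_le {k d : ℕ} (hd : 1 ≤ d) {D : ℝ} (hD : 0 ≤ D)
    {ε : Fin (2 * k + 1 + 1) → ℤ} (hε : ∀ l, |ε l| = 1) (A : Finset ℕ) (q : Fin k → ℕ × ℕ) (u : ℕ) :
    (((smallPowerSum d D ε A).filter
      fun z => (lowerPairs z, z ⟨2 * k, by omega⟩) = (q, u)).card : ℝ) ≤ 2 * D + 1 := by
  set S := (smallPowerSum d D ε A).filter fun z => (lowerPairs z, z ⟨2 * k, by omega⟩) = (q, u)
  have hagree : ∀ z ∈ S, ∀ z' ∈ S, ∀ j : Fin (2 * k + 1), z j.castSucc = z' j.castSucc := by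
    intro z hz z' hz' j
    have h := (Finset.mem_filter.1 hz).2.trans (Finset.mem_filter.1 hz').2.symm
    rw [Prod.mk.injEq] at h
    rcases lt_or_eq_of_le (Nat.lt_succ_iff.1 j.2) with hj | hj
    · have h1 := congrFun h.1 ⟨(j : ℕ) / 2, by omega⟩
      simp only [lowerPairs, Prod.mk.injEq] at h1
      rcases Nat.even_or_odd' (j : ℕ) with ⟨c, hc | hc⟩
      · convert h1.1 using 2 <;> ext <;> simp <;> omega
      · convert h1.2 using 2 <;> ext <;> simp <;> omega
    · convert h.2 using 2 <;> ext <;> simp [hj]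
  have hinj : Set.InjOn (fun z : Fin (2 * k + 1 + 1) → ℕ => z (Fin.last _)) (S : Set _) := by
    intro z hz z' hz' h
    ext j
    refine Fin.lastCases h (fun j => hagree z hz z' hz' j) j
  rw [← Finset.card_image_of_injOn hinj]
  refine card_le_of_forall_sub_le (by linarith) ?_
  intro v hv w hw hwv
  obtain ⟨z, hz, rfl⟩ := Finset.mem_image.1 hv
  obtain ⟨z', hz', rfl⟩ := Finset.mem_image.1 hw
  have hs := (Finset.mem_filter.1 (Finset.mem_filter.1 hz).1).2
  have hs' := (Finset.mem_filter.1 (Finset.mem_filter.1 hz').1).2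
  set v := z (Fin.last _) with hv
  set w := z' (Fin.last _) with hw
  have hvpos : (0 : ℝ) < v := by exact_mod_cast hs.1
  have hwv' : (w : ℝ) ≤ v := by exact_mod_cast hwv
  have hdiff : ∑ l, (ε l : ℝ) * (z l : ℝ) ^ d - ∑ l, (ε l : ℝ) * (z' l : ℝ) ^ d
      = (ε (Fin.last _) : ℝ) * ((v : ℝ) ^ d - (w : ℝ) ^ d) := by
    rw [Fin.sum_univ_castSucc, Fin.sum_univ_castSucc (fun l => (ε l : ℝ) * (z' l : ℝ) ^ d),
      Finset.sum_congr rfl fun j _ => by rw [hagree z hz z' hz' j]]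
    ring
  have hε' : |(ε (Fin.last (2 * k + 1)) : ℝ)| = 1 := by exact_mod_cast hε (Fin.last _)
  have habs : |(v : ℝ) ^ d - (w : ℝ) ^ d| ≤ 2 * D * (v : ℝ) ^ (d - 1) := by
    calc |(v : ℝ) ^ d - (w : ℝ) ^ d|
        = |∑ l, (ε l : ℝ) * (z l : ℝ) ^ d - ∑ l, (ε l : ℝ) * (z' l : ℝ) ^ d| := by
          rw [hdiff, abs_mul, hε', one_mul]
      _ ≤ D * (v : ℝ) ^ (d - 1) + D * (w : ℝ) ^ (d - 1) :=
          (abs_sub _ _).trans (add_le_add hs.2 hs'.2)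
      _ ≤ D * (v : ℝ) ^ (d - 1) + D * (v : ℝ) ^ (d - 1) := by gcongr
      _ = _ := by ring
  have h1 := (mul_sub_le_pow_sub_pow hd hwv).trans ((le_abs_self _).trans habs)
  have h2 : (0 : ℝ) < (v : ℝ) ^ (d - 1) := by positivity
  nlinarith

theorem sum_smallPowerSum_le {k d : ℕ} (hd : 1 ≤ d) {D : ℝ} (hD : 0 ≤ D)
    {ε : Fin (2 * k + 1 + 1) → ℤ} (hε : ∀ l, |ε l| = 1) (A : Finset ℕ) {w : ℕ × ℕ → ℝ}
    (hw : ∀ q, 0 ≤ w q) :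
    ∑ z ∈ smallPowerSum d D ε A, ∏ i, w (lowerPairs z i)
      ≤ (2 * D + 1) * (A.card * (∑ q ∈ A ×ˢ A, w q) ^ k) := by
  classical
  set R := (Fintype.piFinset fun _ : Fin k => A ×ˢ A) ×ˢ A
  have hmap : ∀ z ∈ smallPowerSum d D ε A,
      ((lowerPairs z, z ⟨2 * k, by omega⟩) : (Fin k → ℕ × ℕ) × ℕ) ∈ R := by
    intro z hz
    have hz' := Fintype.mem_piFinset.1 (Finset.mem_filter.1 hz).1
    simp only [R, Finset.mem_product, Fintype.mem_piFinset, lowerPairs]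
    exact ⟨fun i => ⟨hz' _, hz' _⟩, hz' _⟩
  rw [← Finset.sum_fiberwise_of_maps_to hmap]
  calc _ ≤ ∑ r ∈ R, (2 * D + 1) * ∏ i, w (r.1 i) := by
        refine Finset.sum_le_sum fun r _ => ?_
        obtain ⟨q, u⟩ := r
        have : ∀ z ∈ (smallPowerSum d D ε A).filter
            (fun z => (lowerPairs z, z ⟨2 * k, by omega⟩) = (q, u)),
            ∏ i, w (lowerPairs z i) = ∏ i, w (q i) := fun z hz => by
          have h := (Finset.mem_filter.1 hz).2
          rw [Prod.mk.injEq] at h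
          rw [h.1]
        rw [Finset.sum_congr rfl this, Finset.sum_const, nsmul_eq_mul]
        exact mul_le_mul_of_nonneg_right (card_smallPowerSum_fiber_le hd hD hε A q u)
          (Finset.prod_nonneg fun i _ => hw _)
    _ = _ := by
        rw [← Finset.mul_sum, Finset.sum_product]
        simp only [Finset.sum_const, nsmul_eq_mul]
        rw [← Finset.mul_sum, Finset.sum_pow']

/-! ### Even moments of exponential sums -/

theorem integral_fourier_unitAddCircle (m : ℤ) :
    ∫ y : UnitAddCircle, (fourier m y : ℂ) = if m = 0 then 1 else 0 := by
  split_ifs with h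
  · subst h
    simp [measureReal_def]
  · exact integral_eq_zero_of_add_right_eq_neg (fourier_add_half_inv_index h one_pos)

theorem prod_range_two_mul_neg_one_pow {R : Type*} [CommMonoid R] (F : ℤ → R) (n : ℕ) :
    ∏ l ∈ Finset.range (2 * n), F ((-1) ^ l) = (F 1 * F (-1)) ^ n := by
  induction n with
  | zero => simp
  | succ n ih =>
    rw [Nat.mul_succ, Finset.prod_range_succ, Finset.prod_range_succ, ih, pow_succ (F 1 * F (-1)),
      pow_succ, pow_mul]
    simp [mul_assoc]

theorem prod_fourier {ι : Type*} (s : Finset ι) (m : ι → ℤ) (y : UnitAddCircle) :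
    ∏ i ∈ s, (fourier (m i) y : ℂ) = fourier (∑ i ∈ s, m i) y := by
  classical
  induction s using Finset.induction_on with
  | empty => simp
  | insert i s hi ih => rw [Finset.prod_insert hi, Finset.sum_insert hi, ih, fourier_add]

theorem norm_sum_fourier_pow (n : ℕ) (A : Finset ℕ) (a : ℕ → ℤ) (y : UnitAddCircle) :
    ((‖∑ j ∈ A, (fourier (a j) y : ℂ)‖ ^ (2 * n) : ℝ) : ℂ)
      = ∑ t ∈ Fintype.piFinset (fun _ : Fin (2 * n) => A),
          (fourier (∑ l : Fin (2 * n), (-1) ^ (l : ℕ) * a (t l)) y : ℂ) := by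
  have h := prod_range_two_mul_neg_one_pow (fun s => ∑ j ∈ A, (fourier (s * a j) y : ℂ)) n
  have hconj : ∑ j ∈ A, (fourier (-1 * a j) y : ℂ)
      = (starRingEnd ℂ) (∑ j ∈ A, (fourier (a j) y : ℂ)) := by
    rw [map_sum]
    exact Finset.sum_congr rfl fun j _ => by rw [neg_one_mul, fourier_neg]
  simp only [one_mul] at h
  rw [hconj, Complex.mul_conj, Complex.normSq_eq_norm_sq] at h
  rw [pow_mul]
  push_cast at h ⊢
  rw [← h, ← Fin.prod_univ_eq_prod_range (fun l => ∑ j ∈ A, (fourier ((-1) ^ l * a j) y : ℂ)),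
    Finset.prod_univ_sum]
  exact Finset.sum_congr rfl fun t _ => prod_fourier _ _ y

/-- By orthogonality of characters, the `2n`-th moment counts the tuples in `A` whose alternating
sum of frequencies vanishes. -/
theorem eLpNorm_sum_fourier_pow {n : ℕ} (hn : 1 ≤ n) (A : Finset ℕ) (a : ℕ → ℤ) :
    eLpNorm (fun y : UnitAddCircle => ∑ j ∈ A, (fourier (a j) y : ℂ))
        ((2 * n : ℕ) : ℝ≥0∞) volume ^ (2 * n)
      = ∑ t ∈ Fintype.piFinset (fun _ : Fin (2 * n) => A),
          if ∑ l : Fin (2 * n), (-1) ^ (l : ℕ) * a (t l) = 0 then 1 else 0 := by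
  set S : UnitAddCircle → ℂ := fun y => ∑ j ∈ A, (fourier (a j) y : ℂ) with hS
  have hSc : Continuous S := continuous_finsetSum _ fun j _ => (fourier (a j)).continuous
  have hn' : ((2 * n : ℕ) : ℝ) ≠ 0 := by positivity
  have hint : Integrable (fun y => ‖S y‖ ^ (2 * n)) volume :=
    (hSc.norm.pow _).integrable_of_hasCompactSupport (HasCompactSupport.of_compactSpace _)
  rw [eLpNorm_eq_lintegral_rpow_enorm_toReal (by simp; omega) (ENNReal.natCast_ne_top _), ENNReal.toReal_natCast,
    ← ENNReal.rpow_natCast, ← ENNReal.rpow_mul, one_div, inv_mul_cancel₀ hn', ENNReal.rpow_one]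
  have h1 : ∀ y, ‖S y‖ₑ ^ ((2 * n : ℕ) : ℝ) = ENNReal.ofReal (‖S y‖ ^ (2 * n)) := fun y => by
    rw [ENNReal.rpow_natCast, ENNReal.ofReal_pow (norm_nonneg _), ofReal_norm]
  simp only [h1]
  rw [← ofReal_integral_eq_lintegral_ofReal hint (ae_of_all _ fun y => by positivity)]
  have h2 : ∫ y, ‖S y‖ ^ (2 * n) = ∑ t ∈ Fintype.piFinset (fun _ : Fin (2 * n) => A),
      if ∑ l : Fin (2 * n), (-1) ^ (l : ℕ) * a (t l) = 0 then (1 : ℝ) else 0 := by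
    apply Complex.ofReal_injective
    rw [← integral_complex_ofReal]
    simp only [hS, norm_sum_fourier_pow]
    rw [integral_finsetSum _ fun t _ => (fourier _).continuous.integrable_of_hasCompactSupport
      (HasCompactSupport.of_compactSpace _)]
    simp only [integral_fourier_unitAddCircle]
    push_cast
    exact Finset.sum_congr rfl fun t _ => by split_ifs <;> simp
  rw [h2, ENNReal.ofReal_sum_of_nonneg fun t _ => by split_ifs <;> simp]
  exact Finset.sum_congr rfl fun t _ => by split_ifs <;> simp

/-- Every tuple is a rearrangement of a monotone one. -/
theorem sum_piFinset_le_sum_perm {m : ℕ} (A : Finset ℕ) (F : (Fin m → ℕ) → ℝ≥0∞) :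
    ∑ t ∈ Fintype.piFinset (fun _ : Fin m => A), F t
      ≤ ∑ σ : Equiv.Perm (Fin m), ∑ z ∈ Fintype.piFinset (fun _ : Fin m => A) with Monotone z,
          F (z ∘ σ) := by
  classical
  rw [← Finset.sum_fiberwise_of_maps_to (g := fun t => (Tuple.sort t).symm)
    (fun _ _ => Finset.mem_univ _)]
  refine Finset.sum_le_sum fun σ _ => ?_
  have hinj : Set.InjOn (fun t : Fin m → ℕ => t ∘ σ.symm)
      (((Fintype.piFinset fun _ : Fin m => A).filter fun t => (Tuple.sort t).symm = σ :
        Finset (Fin m → ℕ)) : Set (Fin m → ℕ)) :=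
    fun t _ t' _ h => σ.symm.surjective.injective_comp_right h
  calc _ = ∑ z ∈ ((Fintype.piFinset fun _ : Fin m => A).filter
          fun t => (Tuple.sort t).symm = σ).image (fun t : Fin m → ℕ => t ∘ σ.symm), F (z ∘ σ) := by
        rw [Finset.sum_image hinj]
        refine Finset.sum_congr rfl fun t _ => ?_
        congr 1
        ext i; simp
    _ ≤ _ := by
        refine Finset.sum_le_sum_of_subset ?_
        intro z hz
        obtain ⟨t, ht, rfl⟩ := Finset.mem_image.1 hz
        rw [Finset.mem_filter] at ht
        refine Finset.mem_filter.2 ⟨?_, ?_⟩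
        · exact Fintype.mem_piFinset.2 fun i => Fintype.mem_piFinset.1 ht.1 _
        · rw [← ht.2]
          exact Tuple.monotone_sort t

theorem sum_neg_one_pow_comp_perm (n : ℕ) (σ : Equiv.Perm (Fin (2 * n))) :
    ∑ l, (-1 : ℤ) ^ (σ l : ℕ) = 0 := by
  rw [Equiv.sum_comp σ fun l : Fin (2 * n) => (-1 : ℤ) ^ (l : ℕ),
    Fin.sum_univ_eq_sum_range (fun l => (-1 : ℤ) ^ l), neg_one_geom_sum]
  simp

theorem lintegral_powerExpSum_le {Ω : Type*} [MeasurableSpace Ω] {P : Measure Ω}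
    {N : ℝ≥0 → Ω → ℤ} (hN : ∀ t, Measurable (N t)) {n : ℕ} (hn : 1 ≤ n) (d : ℕ) (A : Finset ℕ) :
    ∫⁻ ω, eLpNorm (powerExpSum N d A ω) ((2 * n : ℕ) : ℝ≥0∞) volume ^ (2 * n) ∂P
      ≤ ∑ σ : Equiv.Perm (Fin (2 * n)),
          ∑ z ∈ Fintype.piFinset (fun _ : Fin (2 * n) => A) with Monotone z,
            P {ω | ∑ l, (-1) ^ (σ l : ℕ) * N ((z l : ℝ≥0) ^ d) ω = 0} := by
  have hset : ∀ t : Fin (2 * n) → ℕ,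
      MeasurableSet {ω | ∑ l : Fin (2 * n), (-1) ^ (l : ℕ) * N ((t l : ℝ≥0) ^ d) ω = 0} := fun t =>
    measurableSet_eq_fun (Finset.measurable_sum _ fun l _ => (hN _).const_mul _) measurable_const
  have h : ∫⁻ ω, eLpNorm (powerExpSum N d A ω) ((2 * n : ℕ) : ℝ≥0∞) volume ^ (2 * n) ∂P
      = ∑ t ∈ Fintype.piFinset (fun _ : Fin (2 * n) => A),
          P {ω | ∑ l : Fin (2 * n), (-1) ^ (l : ℕ) * N ((t l : ℝ≥0) ^ d) ω = 0} := by
    have h1 : ∀ ω, eLpNorm (powerExpSum N d A ω) ((2 * n : ℕ) : ℝ≥0∞) volume ^ (2 * n)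
        = ∑ t ∈ Fintype.piFinset (fun _ : Fin (2 * n) => A),
          {ω | ∑ l : Fin (2 * n), (-1) ^ (l : ℕ) * N ((t l : ℝ≥0) ^ d) ω = 0}.indicator 1 ω := fun ω => by
      unfold powerExpSum
      rw [eLpNorm_sum_fourier_pow hn A fun j => N ((j : ℝ≥0) ^ d) ω]
      exact Finset.sum_congr rfl fun t _ => by
        simp only [Set.indicator, Set.mem_ofPred_eq, Pi.one_apply]
    simp only [h1]
    rw [lintegral_finsetSum _ fun t _ => measurable_one.indicator (hset t)]
    exact Finset.sum_congr rfl fun t _ => lintegral_indicator_one (hset t)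
  rw [h]
  refine (sum_piFinset_le_sum_perm A _).trans (le_of_eq ?_)
  -- Moving the permutation from the tuple to the signs inverts it.
  rw [← Equiv.sum_comp (Equiv.inv (Equiv.Perm (Fin (2 * n))))]
  refine Finset.sum_congr rfl fun σ _ => Finset.sum_congr rfl fun z _ => ?_
  congr 1 with ω
  simp only [Set.mem_ofPred_eq, Function.comp_apply, Equiv.inv_apply]
  rw [← Equiv.sum_comp σ]
  simp

/-! ### Monotone tuples with a fixed sign pattern -/

/-- The largest of the `g i` gives the best bound, and `(1 + max g) ^ (-1/2)` is at most the geometric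
mean of the `(1 + g i) ^ (-1/2)`. -/
theorem le_prod_rpow_of_forall_le {k : ℕ} (hk : 1 ≤ k) {p : ℝ} {g : Fin k → ℝ}
    (hg : ∀ i, 0 ≤ g i) (h : ∀ i, p ≤ 2 * (1 + g i) ^ (-(1 / 2 : ℝ))) :
    p ≤ 2 * ∏ i, (1 + g i) ^ (-(1 / (2 * k) : ℝ)) := by
  have hk' : (k : ℝ) ≠ 0 := by positivity
  have : Nonempty (Fin k) := ⟨⟨0, hk⟩⟩
  obtain ⟨i, hi⟩ := Finite.exists_max g
  refine (h i).trans ?_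
  have e : (1 + g i) ^ (-(1 / 2 : ℝ)) = ∏ _j : Fin k, (1 + g i) ^ (-(1 / (2 * k) : ℝ)) := by
    rw [Finset.prod_const, Finset.card_univ, Fintype.card_fin, ← Real.rpow_natCast,
      ← Real.rpow_mul (by linarith [hg i])]
    congr 1
    field_simp
  rw [e]
  refine mul_le_mul_of_nonneg_left (Finset.prod_le_prod (fun j _ => ?_) fun j _ => ?_) two_pos.le
  · exact Real.rpow_nonneg (by linarith [hg i]) _
  · refine Real.rpow_le_rpow_of_nonpos (by linarith [hg j]) (by linarith [hi j]) ?_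
    simp only [Left.neg_nonpos_iff]
    positivity

/-- The Chernoff exponent is at least `2 n log (1 + m)` beyond the threshold, so that the
corresponding probability is negligible even when summed over all `m ^ (2 n)` tuples. -/
theorem exp_neg_sq_div_le {n m : ℕ} (hn : 1 ≤ n) {S W : ℝ} (hW : 0 < W)
    (h : 64 * (n : ℝ) ^ 4 * Real.log (1 + m) * W ≤ S ^ 2) :
    Real.exp (-(S ^ 2 / (4 * (2 * n : ℝ) ^ 3 * W))) ≤ ((1 + m : ℝ) ^ (2 * n))⁻¹ := by
  have hm : (0 : ℝ) < 1 + m := by positivity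
  have e : ((1 + m : ℝ) ^ (2 * n))⁻¹ = Real.exp (-(2 * n * Real.log (1 + m))) := by
    rw [Real.exp_neg]
    have : (2 * n : ℝ) * Real.log (1 + m) = ((2 * n : ℕ) : ℝ) * Real.log (1 + m) := by push_cast; ring
    rw [this, Real.exp_nat_mul, Real.exp_log hm]
  have hn' : (0 : ℝ) < n := by exact_mod_cast hn
  rw [e, Real.exp_le_exp, neg_le_neg_iff, le_div_iff₀ (by positivity)]
  calc _ = 64 * (n : ℝ) ^ 4 * Real.log (1 + m) * W := by ring
    _ ≤ _ := h

/-- The sum over monotone tuples splits into three parts: the tuples with all entries below `X`, the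
tuples whose signed power sum is so large that the Chernoff bound applies, and those with a small
signed power sum. In the last part the gaps of the lower pairs bound the probability, and the
largest entry is determined by the others up to `2 D + 1` choices. -/
theorem sum_monotone_le_of_bounds {k d X : ℕ} (hk : 1 ≤ k) (hd : 1 ≤ d) (hX : 1 ≤ X) {D : ℝ}
    (hD : 0 ≤ D) (A : Finset ℕ) (hA : A.Nonempty)
    (hDX : ∀ x : ℕ, X ≤ x → 64 * ((k + 1 : ℕ) : ℝ) ^ 4 * Real.log (1 + A.card) * (x : ℝ) ^ d
      ≤ (D * (x : ℝ) ^ (d - 1)) ^ 2)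
    {ε : Fin (2 * k + 1 + 1) → ℤ} (hε : ∀ l, |ε l| = 1) {p : (Fin (2 * k + 1 + 1) → ℕ) → ℝ}
    (h1 : ∀ z, p z ≤ 1)
    (hgap : ∀ z, Monotone z → ∀ i : Fin k,
      p z ≤ 2 * (1 + (((lowerPairs z i).2 : ℝ) ^ d - ((lowerPairs z i).1 : ℝ) ^ d)) ^ (-(1 / 2 : ℝ)))
    (hexp : ∀ z, Monotone z → p z ≤ Real.exp (-((∑ l, (ε l : ℝ) * (z l : ℝ) ^ d) ^ 2 /
      (4 * (2 * ((k + 1 : ℕ) : ℝ)) ^ 3 * (z (Fin.last _) : ℝ) ^ d)))) :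
    ∑ z ∈ Fintype.piFinset (fun _ => A) with Monotone z, p z
      ≤ 1 + (X : ℝ) ^ (2 * (k + 1)) + 2 * ((2 * D + 1) * (7 ^ k *
        max ((A.card : ℝ) ^ (k + 1))
          ((A.card : ℝ) ^ (2 * ((k + 1 : ℕ) : ℝ) - (d : ℝ) / 2 - 1)))) := by
  classical
  set m := A.card with hm
  have hm1 : 1 ≤ m := hA.card_pos
  have hm' : (0 : ℝ) < m := by exact_mod_cast hm1
  have hk' : (0 : ℝ) < k := by exact_mod_cast hk
  set w : ℕ × ℕ → ℝ := fun q => (1 + |(q.2 : ℝ) ^ d - (q.1 : ℝ) ^ d|) ^ (-(1 / (2 * k) : ℝ)) with hw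
  have hw0 : ∀ q, 0 ≤ w q := fun q => by positivity
  set Z := Fintype.piFinset (fun _ : Fin (2 * k + 1 + 1) => A) with hZ
  set Q := Fintype.piFinset (fun _ : Fin (2 * k + 1 + 1) => Finset.range X) with hQ
  set G := smallPowerSum d D ε A with hG
  have hpt : ∀ z ∈ Z.filter Monotone, p z ≤ ((1 + m : ℝ) ^ (2 * (k + 1)))⁻¹
      + (if z ∈ Q then 1 else 0) + (if z ∈ G then 2 * ∏ i, w (lowerPairs z i) else 0) := by
    intro z hz
    obtain ⟨hzA, hzm⟩ := Finset.mem_filter.1 hz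
    have hinv : (0 : ℝ) ≤ ((1 + m : ℝ) ^ (2 * (k + 1)))⁻¹ := by positivity
    have hG0 : 0 ≤ if z ∈ G then 2 * ∏ i, w (lowerPairs z i) else 0 := by
      split_ifs
      · exact mul_nonneg two_pos.le (Finset.prod_nonneg fun i _ => hw0 _)
      · exact le_rfl
    have hQ0 : (0 : ℝ) ≤ if z ∈ Q then 1 else 0 := by split_ifs <;> simp
    by_cases hzQ : z ∈ Q
    · rw [if_pos hzQ]
      linarith [h1 z]
    have htop : X ≤ z (Fin.last _) := by
      by_contra hlt
      refine hzQ (Fintype.mem_piFinset.2 fun l => Finset.mem_range.2 ?_)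
      exact (hzm (Fin.le_last l)).trans_lt (not_le.1 hlt)
    by_cases hzG : z ∈ G
    · rw [if_pos hzG]
      have hmono : ∀ i, (0 : ℝ) ≤ ((lowerPairs z i).2 : ℝ) ^ d - ((lowerPairs z i).1 : ℝ) ^ d :=
        fun i => by
          rw [sub_nonneg]
          refine pow_le_pow_left₀ (by positivity) ?_ d
          have : (lowerPairs z i).1 ≤ (lowerPairs z i).2 := hzm (by simp [Fin.le_def])
          exact_mod_cast this
      have h := le_prod_rpow_of_forall_le hk hmono (hgap z hzm)
      have e : ∏ i, w (lowerPairs z i) = ∏ i, (1 + (((lowerPairs z i).2 : ℝ) ^ d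
          - ((lowerPairs z i).1 : ℝ) ^ d)) ^ (-(1 / (2 * k) : ℝ)) :=
        Finset.prod_congr rfl fun i _ => by rw [hw]; simp only [abs_of_nonneg (hmono i)]
      rw [e]
      linarith
    · have hzpos : (0 : ℝ) < z (Fin.last (2 * k + 1)) := by exact_mod_cast hX.trans htop
      have hlarge : D * (z (Fin.last _) : ℝ) ^ (d - 1) < |∑ l, (ε l : ℝ) * (z l : ℝ) ^ d| := by
        by_contra hle
        exact hzG (Finset.mem_filter.2 ⟨hzA, hX.trans htop, not_lt.1 hle⟩)
      have hsq : (D * (z (Fin.last _) : ℝ) ^ (d - 1)) ^ 2 ≤ (∑ l, (ε l : ℝ) * (z l : ℝ) ^ d) ^ 2 := by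
        rw [← sq_abs (∑ l, (ε l : ℝ) * (z l : ℝ) ^ d)]
        exact pow_le_pow_left₀ (by positivity) hlarge.le 2
      have := (hexp z hzm).trans (exp_neg_sq_div_le (by omega) (pow_pos hzpos d)
        ((hDX _ htop).trans hsq))
      linarith
  have hZm : Z.filter Monotone ⊆ Z := Finset.filter_subset _ _
  have hsum1 : ∑ z ∈ Z.filter Monotone, ((1 + m : ℝ) ^ (2 * (k + 1)))⁻¹ ≤ 1 := by
    refine (Finset.sum_le_sum_of_subset_of_nonneg hZm fun _ _ _ => by positivity).trans ?_
    rw [Finset.sum_const, nsmul_eq_mul, hZ, Fintype.card_piFinset_const, ← div_eq_mul_inv,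
      div_le_one (by positivity)]
    push_cast
    exact pow_le_pow_left₀ (by positivity) (by linarith) _
  have hsum2 : ∑ z ∈ Z.filter Monotone, (if z ∈ Q then (1 : ℝ) else 0) ≤ (X : ℝ) ^ (2 * (k + 1)) := by
    rw [← Finset.sum_filter, Finset.sum_const, nsmul_eq_mul, mul_one]
    have : ((Z.filter Monotone).filter (· ∈ Q)).card ≤ Q.card :=
      Finset.card_le_card fun z hz => (Finset.mem_filter.1 hz).2
    rw [hQ, Fintype.card_piFinset_const, Finset.card_range] at this
    exact_mod_cast this
  have hpair : (m : ℝ) * (∑ q ∈ A ×ˢ A, w q) ^ k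
      ≤ 7 ^ k * max ((m : ℝ) ^ (k + 1)) ((m : ℝ) ^ (2 * ((k + 1 : ℕ) : ℝ) - (d : ℝ) / 2 - 1)) := by
    have hα : (1 / (2 * k) : ℝ) ≤ 1 / 2 := by
      rw [div_le_div_iff₀ (by positivity) (by positivity)]
      have : (1 : ℝ) ≤ k := by exact_mod_cast hk
      linarith
    have h := sum_sum_rpow_neg_gap_le hd (α := 1 / (2 * k)) (by positivity) hα A
    have hk1 := pow_le_pow_left₀ (Finset.sum_nonneg fun q _ => hw0 q) h k
    calc (m : ℝ) * (∑ q ∈ A ×ˢ A, w q) ^ k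
        ≤ m * (7 * (m * max 1 ((m : ℝ) ^ (1 - d * (1 / (2 * k) : ℝ))))) ^ k := by gcongr
      _ = 7 ^ k * ((m : ℝ) ^ (k + 1) * max 1 ((m : ℝ) ^ (1 - d * (1 / (2 * k) : ℝ))) ^ k) := by
          rw [mul_pow, mul_pow]; ring
      _ ≤ _ := by
          gcongr
          rcases le_total ((m : ℝ) ^ (1 - d * (1 / (2 * k) : ℝ))) 1 with h | h
          · rw [max_eq_left h, one_pow, mul_one]; exact le_max_left _ _
          · rw [max_eq_right h]
            refine le_of_eq_of_le ?_ (le_max_right _ _)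
            rw [← Real.rpow_natCast, ← Real.rpow_natCast, ← Real.rpow_mul hm'.le,
              ← Real.rpow_add hm']
            congr 1
            push_cast
            field_simp
            ring
  have hsum3 : ∑ z ∈ Z.filter Monotone, (if z ∈ G then 2 * ∏ i, w (lowerPairs z i) else 0)
      ≤ 2 * ((2 * D + 1) * (7 ^ k *
        max ((m : ℝ) ^ (k + 1)) ((m : ℝ) ^ (2 * ((k + 1 : ℕ) : ℝ) - (d : ℝ) / 2 - 1)))) := by
    rw [← Finset.sum_filter, ← Finset.mul_sum]
    refine mul_le_mul_of_nonneg_left ?_ two_pos.le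
    calc _ ≤ ∑ z ∈ G, ∏ i, w (lowerPairs z i) :=
          Finset.sum_le_sum_of_subset_of_nonneg (fun z hz => (Finset.mem_filter.1 hz).2)
            fun z _ _ => Finset.prod_nonneg fun i _ => hw0 _
      _ ≤ (2 * D + 1) * (m * (∑ q ∈ A ×ˢ A, w q) ^ k) := sum_smallPowerSum_le hd hD hε A hw0
      _ ≤ _ := by gcongr
  calc _ ≤ ∑ z ∈ Z.filter Monotone, (((1 + m : ℝ) ^ (2 * (k + 1)))⁻¹
      + (if z ∈ Q then 1 else 0) + (if z ∈ G then 2 * ∏ i, w (lowerPairs z i) else 0)) :=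
        Finset.sum_le_sum hpt
    _ ≤ _ := by
        rw [Finset.sum_add_distrib, Finset.sum_add_distrib]
        linarith

section process

variable {Ω : Type*} [MeasurableSpace Ω] {P : Measure Ω} [IsProbabilityMeasure P]
  {N : ℝ≥0 → Ω → ℤ}

theorem odd_sum_Iic_of_even {k : ℕ} {ε : Fin (2 * k + 1 + 1) → ℤ} (hε : ∀ l, |ε l| = 1)
    (i : Fin k) :
    Odd (∑ j : Fin (2 * k + 1 + 1),
      if j ≤ (⟨2 * i, by omega⟩ : Fin (2 * k + 1)).castSucc then ε j else 0) := by
  have hodd : ∀ j, Odd (ε j) := fun j => by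
    rcases abs_eq (zero_le_one) |>.1 (hε j) with h | h <;> rw [h] <;> decide
  choose c hc using hodd
  rw [← Finset.sum_filter, Finset.sum_congr rfl fun j _ => hc j, Finset.sum_add_distrib,
    ← Finset.mul_sum, Finset.sum_const, Finset.filter_ge_eq_Iic, Fin.card_Iic]
  exact (even_two_mul _).add_odd ⟨i, by simp⟩

theorem IsPoissonProcess.sum_monotone_le (hN : IsPoissonProcess N 1 P) {k d X : ℕ} (hk : 1 ≤ k)
    (hd : 1 ≤ d) (hX : 1 ≤ X) {D : ℝ} (hD : 0 ≤ D) (A : Finset ℕ) (hA : A.Nonempty)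
    (hDX : ∀ x : ℕ, X ≤ x → 64 * ((k + 1 : ℕ) : ℝ) ^ 4 * Real.log (1 + A.card) * (x : ℝ) ^ d
      ≤ (D * (x : ℝ) ^ (d - 1)) ^ 2)
    {ε : Fin (2 * k + 1 + 1) → ℤ} (hε : ∀ l, |ε l| = 1) (hε0 : ∑ l, ε l = 0) :
    ∑ z ∈ Fintype.piFinset (fun _ => A) with Monotone z,
        P.real {ω | ∑ l, ε l * N ((z l : ℝ≥0) ^ d) ω = 0}
      ≤ 1 + (X : ℝ) ^ (2 * (k + 1)) + 2 * ((2 * D + 1) * (7 ^ k *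
        max ((A.card : ℝ) ^ (k + 1))
          ((A.card : ℝ) ^ (2 * ((k + 1 : ℕ) : ℝ) - (d : ℝ) / 2 - 1)))) := by
  have hmono : ∀ z : Fin (2 * k + 1 + 1) → ℕ, Monotone z → Monotone fun l => (z l : ℝ≥0) ^ d :=
    fun z hz l l' h => pow_le_pow_left₀ (by positivity) (by exact_mod_cast hz h) d
  refine sum_monotone_le_of_bounds hk hd hX hD A hA hDX hε
    (fun z => measureReal_le_one) (fun z hz i => ?_) fun z hz => ?_
  · have h := hN.measure_sum_eq_zero_le_of_odd (hmono z hz) hε0 (odd_sum_Iic_of_even hε i)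
    have hb : (0 : ℝ) ≤ ((lowerPairs z i).2 : ℝ) ^ d - ((lowerPairs z i).1 : ℝ) ^ d := by
      rw [sub_nonneg]
      refine pow_le_pow_left₀ (by positivity) ?_ d
      have : (lowerPairs z i).1 ≤ (lowerPairs z i).2 := hz (by simp [Fin.le_def])
      exact_mod_cast this
    refine ENNReal.toReal_le_of_le_ofReal (by positivity) ?_
    simpa [lowerPairs] using h
  · have h := hN.measure_sum_eq_zero_le_exp (hmono z hz) hε0 hε
      (W := (z (Fin.last _) : ℝ) ^ d) (by push_cast; linarith [pow_nonneg (Nat.cast_nonneg (α := ℝ) (z 0)) d])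
    refine ENNReal.toReal_le_of_le_ofReal (by positivity) ?_
    convert h using 7
    · push_cast; rfl
    · push_cast; ring

end process

/-! ### The estimates for the individual ranges of the parameters -/

theorem half_le_log_one_add {m : ℝ} (hm : 1 ≤ m) : 1 / 2 ≤ Real.log (1 + m) := by
  have h := Real.log_le_log two_pos (by linarith : (2 : ℝ) ≤ 1 + m)
  have := Real.log_two_gt_d9
  linarith

theorem max_le_four_mul_max_log {m a b p : ℝ} (hm : 1 ≤ m) (ha : 0 ≤ a) (hb : 0 ≤ b) (hp0 : 0 ≤ p)
    (hp : p ≤ 2) : max a b ≤ 4 * max a (b * Real.log (1 + m) ^ p) := by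
  have hL := half_le_log_one_add hm
  have h1 : (1 / 4 : ℝ) ≤ Real.log (1 + m) ^ p := by
    calc (1 / 4 : ℝ) = (1 / 2 : ℝ) ^ (2 : ℝ) := by norm_num
      _ ≤ (1 / 2 : ℝ) ^ p := Real.rpow_le_rpow_of_exponent_ge (by norm_num) (by norm_num) hp
      _ ≤ _ := Real.rpow_le_rpow (by norm_num) hL hp0
  have h2 := le_max_left a (b * Real.log (1 + m) ^ p)
  have h3 := le_max_right a (b * Real.log (1 + m) ^ p)
  refine max_le (by linarith) ?_
  nlinarith [mul_le_mul_of_nonneg_left h1 hb]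

theorem ceil_log_pow_le {m : ℝ} (hm : 1 ≤ m) (j : ℕ) :
    (⌈Real.log (1 + m)⌉₊ : ℝ) ^ j ≤ 6 * j.factorial * m := by
  have hL := half_le_log_one_add hm
  have h1 : (⌈Real.log (1 + m)⌉₊ : ℝ) ≤ Real.log (1 + m) + 1 := (Nat.ceil_lt_add_one (by linarith)).le
  have h2 := Real.pow_div_factorial_le_exp (Real.log (1 + m) + 1) (by linarith) j
  rw [Real.exp_add, Real.exp_log (by linarith), div_le_iff₀ (by positivity)] at h2
  have h3 := Real.exp_one_lt_d9
  calc _ ≤ (Real.log (1 + m) + 1) ^ j := pow_le_pow_left₀ (by positivity) h1 j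
    _ ≤ (1 + m) * Real.exp 1 * j.factorial := h2
    _ ≤ (6 * m) * j.factorial := by
        refine mul_le_mul_of_nonneg_right ?_ (by positivity)
        nlinarith [Real.exp_pos 1]
    _ = _ := by ring

theorem sum_exp_neg_sub_le (A : Finset ℕ) (x : ℕ) :
    ∑ y ∈ A with x ≤ y, Real.exp (-(((y : ℝ) - x) / 32)) ≤ (1 - Real.exp (-(1 / 32)))⁻¹ := by
  have hr : Real.exp (-(1 / 32)) < 1 := Real.exp_lt_one_iff.2 (by norm_num)
  have hinj : Set.InjOn (fun y => y - x) ((A.filter fun y => x ≤ y : Finset ℕ) : Set ℕ) := by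
    intro y hy y' hy' h
    have h1 := (Finset.mem_filter.1 hy).2
    have h2 := (Finset.mem_filter.1 hy').2
    simp only at h
    omega
  calc ∑ y ∈ A with x ≤ y, Real.exp (-(((y : ℝ) - x) / 32))
      = ∑ h ∈ (A.filter fun y => x ≤ y).image (fun y => y - x), Real.exp (-(1 / 32)) ^ h := by
        rw [Finset.sum_image hinj]
        refine Finset.sum_congr rfl fun y hy => ?_
        rw [← Real.exp_nat_mul, Nat.cast_sub (Finset.mem_filter.1 hy).2]
        congr 1; ring
    _ ≤ ∑' h : ℕ, Real.exp (-(1 / 32)) ^ h :=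
        (summable_geometric_of_lt_one (Real.exp_pos _).le hr).sum_le_tsum _
          fun h _ => by positivity
    _ = _ := tsum_geometric_of_lt_one (Real.exp_pos _).le hr

section process

variable {Ω : Type*} [MeasurableSpace Ω] {P : Measure Ω} [IsProbabilityMeasure P]
  {N : ℝ≥0 → Ω → ℤ}

/-- For two entries the signed sum is `±` an increment over an interval of length
`z_1 ^ d - z_0 ^ d ≥ z_1 - z_0`, which vanishes with exponentially small probability. -/
theorem IsPoissonProcess.sum_monotone_two_le (hN : IsPoissonProcess N 1 P) {d : ℕ} (hd : 1 ≤ d)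
    (A : Finset ℕ) {ε : Fin 2 → ℤ} (hε : ∀ l, |ε l| = 1) (hε0 : ∑ l, ε l = 0) :
    ∑ z ∈ Fintype.piFinset (fun _ : Fin 2 => A) with Monotone z,
        P.real {ω | ∑ l, ε l * N ((z l : ℝ≥0) ^ d) ω = 0}
      ≤ (1 - Real.exp (-(1 / 32)))⁻¹ * A.card := by
  have hbound : ∀ z ∈ (Fintype.piFinset (fun _ : Fin 2 => A)).filter Monotone,
      P.real {ω | ∑ l, ε l * N ((z l : ℝ≥0) ^ d) ω = 0}
        ≤ Real.exp (-(((z 1 : ℝ) - z 0) / 32)) := by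
    intro z hz
    have hzm := (Finset.mem_filter.1 hz).2
    have hz01 : z 0 ≤ z 1 := hzm (by decide)
    have hmono : Monotone fun l => (z l : ℝ≥0) ^ d :=
      fun l l' h => pow_le_pow_left₀ (by positivity) (by exact_mod_cast hzm h) d
    have h := hN.measure_sum_eq_zero_le_exp (M := 1) hmono hε0 hε
      (W := (z 1 : ℝ) ^ d - (z 0 : ℝ) ^ d) (by push_cast; exact le_rfl)
    refine (ENNReal.toReal_le_of_le_ofReal (by positivity) h).trans ?_
    rw [Real.exp_le_exp, neg_le_neg_iff]
    have hgap : (z 1 : ℝ) - z 0 ≤ (z 1 : ℝ) ^ d - (z 0 : ℝ) ^ d := by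
      rcases Nat.eq_zero_or_pos (z 1) with h0 | hpos
      · have : z 0 = 0 := by omega
        rw [h0, this]; simp
      · refine le_trans ?_ (mul_sub_le_pow_sub_pow hd hz01)
        have h1 : (1 : ℝ) ≤ (z 1 : ℝ) ^ (d - 1) := one_le_pow₀ (by exact_mod_cast hpos)
        have h2 : (0 : ℝ) ≤ (z 1 : ℝ) - z 0 := sub_nonneg.2 (by exact_mod_cast hz01)
        nlinarith
    set W := (z 1 : ℝ) ^ d - (z 0 : ℝ) ^ d with hW
    have hsq : (∑ l, (ε l : ℝ) * (((z l : ℝ≥0) ^ d : ℝ≥0) : ℝ)) ^ 2 = W ^ 2 := by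
      rw [Fin.sum_univ_two] at hε0 ⊢
      have h0 : (ε 0 : ℝ) = -(ε 1 : ℝ) := by
        have : ε 0 = -ε 1 := by linarith
        exact_mod_cast this
      have h1 : (ε 1 : ℝ) ^ 2 = 1 := by
        have : |(ε 1 : ℝ)| = 1 := by exact_mod_cast hε 1
        rw [← sq_abs, this, one_pow]
      rw [h0]
      push_cast
      calc _ = (ε 1 : ℝ) ^ 2 * W ^ 2 := by rw [hW]; ring
        _ = W ^ 2 := by rw [h1, one_mul]
    rw [hsq]
    rcases eq_or_ne W 0 with h0 | h0
    · rw [h0] at hgap ⊢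
      simp only [ne_eq, OfNat.ofNat_ne_zero, not_false_eq_true, zero_pow, mul_zero, div_zero]
      linarith
    · have : W ^ 2 / (4 * (((1 : ℕ) : ℝ) + 1) ^ 3 * W) = W / 32 := by
        push_cast; field_simp; norm_num
      rw [this]
      linarith
  have hinj : Set.InjOn (fun z : Fin 2 → ℕ => (z 0, z 1))
      (((Fintype.piFinset (fun _ : Fin 2 => A)).filter Monotone : Finset _) : Set (Fin 2 → ℕ)) := by
    intro z _ z' _ h
    rw [Prod.mk.injEq] at h
    ext i
    fin_cases i
    · exact h.1
    · exact h.2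
  calc _ ≤ ∑ z ∈ Fintype.piFinset (fun _ : Fin 2 => A) with Monotone z,
          Real.exp (-(((z 1 : ℝ) - z 0) / 32)) := Finset.sum_le_sum hbound
    _ = ∑ q ∈ ((Fintype.piFinset (fun _ : Fin 2 => A)).filter Monotone).image
          (fun z : Fin 2 → ℕ => (z 0, z 1)), Real.exp (-(((q.2 : ℝ) - q.1) / 32)) := by
        rw [Finset.sum_image hinj]
    _ ≤ ∑ q ∈ A ×ˢ A with q.1 ≤ q.2, Real.exp (-(((q.2 : ℝ) - q.1) / 32)) := by
        refine Finset.sum_le_sum_of_subset_of_nonneg ?_ fun _ _ _ => by positivity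
        intro q hq
        obtain ⟨z, hz, rfl⟩ := Finset.mem_image.1 hq
        obtain ⟨hzA, hzm⟩ := Finset.mem_filter.1 hz
        rw [Fintype.mem_piFinset] at hzA
        exact Finset.mem_filter.2 ⟨Finset.mem_product.2 ⟨hzA 0, hzA 1⟩, hzm (by decide)⟩
    _ = ∑ x ∈ A, ∑ y ∈ A with x ≤ y, Real.exp (-(((y : ℝ) - x) / 32)) := by
        rw [Finset.sum_filter, Finset.sum_product]
        exact Finset.sum_congr rfl fun x _ => by rw [Finset.sum_filter]
    _ ≤ _ := by
        rw [mul_comm, ← nsmul_eq_mul]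
        exact Finset.sum_le_card_nsmul _ _ _ fun x _ => sum_exp_neg_sub_le A x

/-- For `d ≥ 3` and `x ≥ log (1 + |A|)` the range allowed by the Chernoff bound for a `d`-th power
near `x ^ d` is at most a constant times `x ^ (d - 1)`. The tuples with smaller entries are
so few that they may be counted trivially. -/
theorem IsPoissonProcess.sum_monotone_le_of_three_le (hN : IsPoissonProcess N 1 P) {k d : ℕ}
    (hk : 1 ≤ k) (hd : 3 ≤ d) (A : Finset ℕ) (hA : A.Nonempty)
    {ε : Fin (2 * k + 1 + 1) → ℤ} (hε : ∀ l, |ε l| = 1) (hε0 : ∑ l, ε l = 0) :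
    ∑ z ∈ Fintype.piFinset (fun _ => A) with Monotone z,
        P.real {ω | ∑ l, ε l * N ((z l : ℝ≥0) ^ d) ω = 0}
      ≤ (1 + 6 * (2 * (k + 1)).factorial + 2 * ((2 * (8 * ((k + 1 : ℕ) : ℝ) ^ 2) + 1) * 7 ^ k)) *
        max ((A.card : ℝ) ^ (k + 1)) ((A.card : ℝ) ^ (2 * ((k + 1 : ℕ) : ℝ) - (d : ℝ) / 2 - 1)) := by
  have hm : (1 : ℝ) ≤ A.card := by exact_mod_cast hA.card_pos
  have hL := half_le_log_one_add hm
  set L := Real.log (1 + (A.card : ℝ)) with hLdef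
  have hX : 1 ≤ ⌈L⌉₊ := Nat.one_le_iff_ne_zero.2 (Nat.ceil_pos.2 (by linarith)).ne'
  have h := hN.sum_monotone_le hk (by omega : 1 ≤ d) hX (D := 8 * ((k + 1 : ℕ) : ℝ) ^ 2)
    (by positivity) A hA (fun x hx => ?_) hε hε0
  · refine h.trans ?_
    set Mx := max ((A.card : ℝ) ^ (k + 1))
      ((A.card : ℝ) ^ (2 * ((k + 1 : ℕ) : ℝ) - (d : ℝ) / 2 - 1)) with hMx
    have hmM : (A.card : ℝ) ≤ Mx := (le_self_pow₀ hm (by omega)).trans (le_max_left _ _)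
    have h1 := ceil_log_pow_le hm (2 * (k + 1))
    have h2 : 6 * ((2 * (k + 1)).factorial : ℝ) * A.card ≤ 6 * ((2 * (k + 1)).factorial : ℝ) * Mx :=
      mul_le_mul_of_nonneg_left hmM (by positivity)
    calc _ ≤ Mx + 6 * ((2 * (k + 1)).factorial : ℝ) * Mx
          + 2 * ((2 * (8 * ((k + 1 : ℕ) : ℝ) ^ 2) + 1) * (7 ^ k * Mx)) := by
          refine add_le_add_left (add_le_add (hm.trans hmM) (h1.trans h2)) _
      _ = _ := by ring
  · have hxL : L ≤ x := (Nat.le_ceil L).trans (by exact_mod_cast hx)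
    have hx1 : (1 : ℝ) ≤ x := by exact_mod_cast hX.trans hx
    have h1 : L * (x : ℝ) ^ d ≤ ((x : ℝ) ^ (d - 1)) ^ 2 := by
      calc L * (x : ℝ) ^ d ≤ x * (x : ℝ) ^ d := by gcongr
        _ = (x : ℝ) ^ (d + 1) := by ring
        _ ≤ (x : ℝ) ^ ((d - 1) * 2) := pow_le_pow_right₀ hx1 (by omega)
        _ = _ := pow_mul _ _ _
    calc _ = 64 * ((k + 1 : ℕ) : ℝ) ^ 4 * (L * (x : ℝ) ^ d) := by ring
      _ ≤ 64 * ((k + 1 : ℕ) : ℝ) ^ 4 * ((x : ℝ) ^ (d - 1)) ^ 2 := by gcongr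
      _ = _ := by ring

/-- For fourth moments of squares the largest entry is determined up to `O(log ^ (1/2))` choices
only, which the logarithmic factor in the bound absorbs. -/
theorem IsPoissonProcess.sum_monotone_four_le (hN : IsPoissonProcess N 1 P) (A : Finset ℕ)
    (hA : A.Nonempty) {ε : Fin (2 * 1 + 1 + 1) → ℤ} (hε : ∀ l, |ε l| = 1) (hε0 : ∑ l, ε l = 0) :
    ∑ z ∈ Fintype.piFinset (fun _ => A) with Monotone z,
        P.real {ω | ∑ l, ε l * N ((z l : ℝ≥0) ^ 2) ω = 0}
      ≤ 1808 * max ((A.card : ℝ) ^ 2) ((A.card : ℝ) ^ 2 * Real.log (1 + A.card) ^ (3 / 2 : ℝ)) := by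
  have hm : (1 : ℝ) ≤ A.card := by exact_mod_cast hA.card_pos
  have hL := half_le_log_one_add hm
  set m := (A.card : ℝ) with hmdef
  set L := Real.log (1 + m) with hLdef
  have hs : √L ^ 2 = L := Real.sq_sqrt (by linarith)
  -- With `n = 2` the threshold is `64 * 2 ^ 4 * L * x ^ 2 = (32 * √L * x) ^ 2`.
  have h := hN.sum_monotone_le (k := 1) (d := 2) le_rfl (by norm_num) (le_refl 1) (D := 32 * √L)
    (by positivity) A hA (fun x _ => ?_) hε hε0
  · refine h.trans ?_
    have he : m ^ (2 * ((1 + 1 : ℕ) : ℝ) - ((2 : ℕ) : ℝ) / 2 - 1) = m ^ 2 := by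
      rw [← Real.rpow_natCast]; norm_num
    rw [← hmdef, he, max_self]
    have hm2 : 1 ≤ m ^ 2 := one_le_pow₀ hm
    have hsL : √L ≤ 2 * L ^ (3 / 2 : ℝ) := by
      have : L ^ (3 / 2 : ℝ) = √L * L := by
        rw [Real.sqrt_eq_rpow, ← Real.rpow_add_one (by linarith)]; norm_num
      rw [this]
      nlinarith [Real.sqrt_nonneg L]
    have h1 := le_max_left (m ^ 2) (m ^ 2 * L ^ (3 / 2 : ℝ))
    have h2 := le_max_right (m ^ 2) (m ^ 2 * L ^ (3 / 2 : ℝ))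
    have h3 : m ^ 2 * √L ≤ 2 * (m ^ 2 * L ^ (3 / 2 : ℝ)) := by
      have := mul_le_mul_of_nonneg_left hsL (sq_nonneg m)
      linarith
    -- `1 + 1 + 14 (64 √L + 1) m ^ 2 ≤ (16 + 1792) max (…)`
    norm_num
    linarith
  · rw [mul_pow, mul_pow, hs]
    norm_num
    linarith

end process

theorem exists_forall_sum_monotone_le (n d : ℕ) (hn : 1 ≤ n) (hnd : n ≤ d) :
    ∃ C : ℝ, 0 < C ∧
      ∀ {Ω : Type*} [MeasurableSpace Ω] (P : Measure Ω) [IsProbabilityMeasure P]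
        (N : ℝ≥0 → Ω → ℤ), IsPoissonProcess N 1 P →
        ∀ A : Finset ℕ, A.Nonempty → ∀ ε : Fin (2 * n) → ℤ, (∀ l, |ε l| = 1) → ∑ l, ε l = 0 →
          ∑ z ∈ Fintype.piFinset (fun _ => A) with Monotone z,
              P.real {ω | ∑ l, ε l * N ((z l : ℝ≥0) ^ d) ω = 0} ≤
            C * if d % 4 = 2 then
                max ((A.card : ℝ) ^ n)
                  ((A.card : ℝ) ^ (2 * (n : ℝ) - (d : ℝ) / 2 - 1) *
                    Real.log (1 + (A.card : ℝ)) ^ (1 + 1 / (d : ℝ)))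
              else
                max ((A.card : ℝ) ^ n)
                  ((A.card : ℝ) ^ (2 * (n : ℝ) - (d : ℝ) / 2 - 1) *
                    Real.log (1 + (A.card : ℝ)) ^ (1 / (d : ℝ))) := by
  rcases hn.eq_or_lt with rfl | hn2
  · have hr : Real.exp (-(1 / 32)) < 1 := Real.exp_lt_one_iff.2 (by norm_num)
    refine ⟨(1 - Real.exp (-(1 / 32)))⁻¹, inv_pos.2 (by linarith), ?_⟩
    intro Ω _ P _ N hN A hA ε hε hε0
    refine (hN.sum_monotone_two_le hnd A hε hε0).trans
      (mul_le_mul_of_nonneg_left ?_ (inv_nonneg.2 (by linarith)))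
    split_ifs <;> exact (pow_one (A.card : ℝ)).symm.le.trans (le_max_left _ _)
  obtain ⟨k, rfl⟩ := Nat.exists_eq_add_of_le' hn
  have hk : 1 ≤ k := by omega
  rcases (by omega : d = 2 ∨ 3 ≤ d) with rfl | hd
  · obtain rfl : k = 1 := by omega
    -- Here `d % 4 = 2`, and the exponent of the logarithm is `1 + 1 / 2 = 3 / 2`.
    refine ⟨1808, by norm_num, ?_⟩
    intro Ω _ P _ N hN A hA ε hε hε0
    refine (hN.sum_monotone_four_le A hA hε hε0).trans (le_of_eq ?_)
    have he : (A.card : ℝ) ^ (2 * ((1 + 1 : ℕ) : ℝ) - ((2 : ℕ) : ℝ) / 2 - 1) = (A.card : ℝ) ^ 2 := by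
      rw [← Real.rpow_natCast]; norm_num
    rw [if_pos (by norm_num), he]
    norm_num
  · set C := (1 + 6 * (2 * (k + 1)).factorial
      + 2 * ((2 * (8 * ((k + 1 : ℕ) : ℝ) ^ 2) + 1) * 7 ^ k)) with hC
    have hC0 : 0 < C := by positivity
    refine ⟨C * 4, by positivity, ?_⟩
    intro Ω _ P _ N hN A hA ε hε hε0
    refine (hN.sum_monotone_le_of_three_le hk hd A hA hε hε0).trans ?_
    rw [mul_assoc]
    refine mul_le_mul_of_nonneg_left ?_ hC0.le
    have hm : (1 : ℝ) ≤ A.card := by exact_mod_cast hA.card_pos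
    have hd1 : 1 / (d : ℝ) ≤ 1 := by
      rw [div_le_one (by positivity)]; exact_mod_cast (by omega : 1 ≤ d)
    have hd0 : 0 ≤ 1 / (d : ℝ) := by positivity
    split_ifs
    · exact max_le_four_mul_max_log hm (by positivity) (by positivity) (by linarith) (by linarith)
    · exact max_le_four_mul_max_log hm (by positivity) (by positivity) hd0 (by linarith)

theorem theorem7 (n d : ℕ) (hn : 1 ≤ n) (hnd : n ≤ d) :
    ∃ C : ℝ, 0 < C ∧
      ∀ {Ω : Type*} [MeasurableSpace Ω] (P : Measure Ω) [IsProbabilityMeasure P]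
        (N : ℝ≥0 → Ω → ℤ), IsPoissonProcess N 1 P →
        ∀ A : Finset ℕ, A.Nonempty →
          ∫⁻ ω, eLpNorm (powerExpSum N d A ω) ((2 * n : ℕ) : ℝ≥0∞) volume ^ (2 * n) ∂P ≤
            ENNReal.ofReal (C *
              if d % 4 = 2 then
                max ((A.card : ℝ) ^ n)
                  ((A.card : ℝ) ^ (2 * (n : ℝ) - (d : ℝ) / 2 - 1) *
                    Real.log (1 + (A.card : ℝ)) ^ (1 + 1 / (d : ℝ)))
              else
                max ((A.card : ℝ) ^ n)
                  ((A.card : ℝ) ^ (2 * (n : ℝ) - (d : ℝ) / 2 - 1) *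
                    Real.log (1 + (A.card : ℝ)) ^ (1 / (d : ℝ)))) := by
  obtain ⟨C, hC, h⟩ := exists_forall_sum_monotone_le n d hn hnd
  refine ⟨(2 * n).factorial * C, by positivity, ?_⟩
  intro Ω _ P _ N hN A hA
  refine (lintegral_powerExpSum_le hN.measurable hn d A).trans ?_
  have hσ : ∀ σ : Equiv.Perm (Fin (2 * n)),
      ∑ z ∈ Fintype.piFinset (fun _ : Fin (2 * n) => A) with Monotone z,
        P {ω | ∑ l, (-1) ^ (σ l : ℕ) * N ((z l : ℝ≥0) ^ d) ω = 0} ≤ ENNReal.ofReal (C * _) :=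
    fun σ => by
      have := h P N hN A hA (fun l => (-1) ^ (σ l : ℕ)) (fun l => by simp)
        (sum_neg_one_pow_comp_perm n σ)
      refine le_of_eq_of_le ?_ (ENNReal.ofReal_le_ofReal this)
      rw [ENNReal.ofReal_sum_of_nonneg fun z _ => measureReal_nonneg]
      exact Finset.sum_congr rfl fun z _ => (ofReal_measureReal).symm
  refine (Finset.sum_le_card_nsmul _ _ _ fun σ _ => hσ σ).trans (le_of_eq ?_)
  rw [Finset.card_univ, Fintype.card_perm, Fintype.card_fin, nsmul_eq_mul, mul_assoc,
    ENNReal.ofReal_mul (by positivity : (0 : ℝ) ≤ ((2 * n).factorial : ℝ)), ENNReal.ofReal_natCast]
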